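/- Index the standard basis of $\mathbb C^2\otimes\mathbb C^2\otimes\mathbb C^2$ (subsystems $A,B,C$) lexicographically, so that matrices in $M_2\otimes M_2\otimes M_2$ are $8\times 8$ matrices. Let $\alpha$ (resp. $\beta$, $\gamma$) be the convex cone of all unnormalized $A$-$BC$ (resp. $B$-$CA$, $C$-$AB$) separable three qubit states, that is, of all finite nonnegative combinations of the rank one matrices $|x\otimes y\rangle\langle x\otimes y|$ that are product vectors for this bipartition. For convex cones $\sigma,\tau$ let $\sigma\wedge\tau$ be the intersection and $\sigma\vee\tau$ the convex hull of the union, i.e. the sum. For $a,z\in\mathbb R^4$ let $X\binom{a_1\,a_2\,a_3\,a_4}{z_1\,z_2\,z_3\,z_4}$ be the $8\times 8$ matrix with diagonal $(a_1,a_2,a_3,a_4,a_4,a_3,a_2,a_1)$, with anti-diagonal $(z_1,z_2,z_3,z_4,z_4,z_3,z_2,z_1)$ and with all other entries $0$, and let $V$ be the eight dimensional real vector space of all these (GHZ diagonal) matrices. An extreme ray of a convex cone $K$ is a ray $\{c\varrho: c\ge 0\}$, $\varrho\neq 0$, which is a face of $K$. For each of the following nine cones $\sigma$, the matrices in the list $\mathcal{CE}_\sigma$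 generate pairwise distinct extreme rays of $\sigma\cap V$, and every extreme ray of $\sigma\cap V$ is generated by one of them; their number is given in brackets. Below, $\binom{a}{z}$ stands for all $X\binom{a_1\,a_2\,a_3\,a_4}{\pm z_1\,\pm z_2\,\pm z_3\,\pm z_4}$ with independent choices of signs (a sign in front of $0$ being irrelevant), and $\Delta=\{\binom{1000}{0000},\binom{0100}{0000},\binom{0010}{0000},\binom{0001}{0000}\}$. 1. $\alpha\wedge\beta\wedge\gamma$: $\Delta$, $\binom{1111}{1111}$ [20]. 2. $\alpha\wedge\beta$: the list in 1 together with $\binom{1011}{1000},\binom{0111}{0100},\binom{1110}{0010},\binom{1101}{0001}$ [28]. 3. $(\alpha\wedge\beta)\vee(\alpha\wedge\gamma)$: the list in 2 together with $\binom{1101}{1000},\binom{0111}{0010},\binom{1110}{0100},\binom{1011}{0001}$ [36]. 4. $\alpha\wedge(\beta\vee\gamma)$: the list in 3 together with $\binom{1201}{1001},\binom{1021}{1001},\binom{2110}{0110},\binom{0112}{0110},\binom{1221}{1201},\binom{1221}{1021},\binom{2112}{2110},\binom{2112}{0112}$ [84]. 5. $\alpha$: $\Delta$, $\binom{1001}{1001},\binom{0110}{0110}$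 [12]. 6. $\alpha\vee(\beta\wedge\gamma)$: the list in 5 together with $\binom{1110}{1000},\binom{0111}{0001},\binom{1101}{0100},\binom{1011}{0010}$ [20]. 7. $(\alpha\vee\beta)\wedge(\alpha\vee\gamma)$: the list in 6 together with $\binom{1120}{1100},\binom{1210}{1010},\binom{2101}{0101},\binom{2011}{0011},\binom{1102}{1100},\binom{1012}{1010},\binom{0121}{0101},\binom{0211}{0011}$ [52]. 8. $\alpha\vee\beta$: $\Delta$, $\binom{1001}{1001},\binom{0110}{0110},\binom{1010}{1010},\binom{0101}{0101}$ [20]. 9. $\alpha\vee\beta\vee\gamma$: the list in 8 together with $\binom{1100}{1100},\binom{0011}{0011}$ [28]. -/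

import Mathlib

open scoped ComplexConjugate

/-- Basis labels `(i, j, k)` of the three qubit space `ℂ² ⊗ ℂ² ⊗ ℂ²` (subsystems `A`, `B`, `C`). -/
abbrev Qubits3 : Type := Fin 2 × Fin 2 × Fin 2

/-- `8 × 8` matrices, that is, elements of `M₂ ⊗ M₂ ⊗ M₂`. -/
abbrev Mat3 : Type := Matrix Qubits3 Qubits3 ℂ

/-- The (unnormalized) pure state `|v⟩⟨v|`. -/
noncomputable def pureState (v : Qubits3 → ℂ) : Mat3 := Matrix.vecMulVec v (star v)

/-- `α`: the convex cone of all unnormalized `A`-`BC` separable states, i.e. all finite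
nonnegative combinations of pure product states `|x ⊗ y⟩⟨x ⊗ y|` with `x` in `A` and `y` in `BC`. -/
noncomputable def alphaCone : PointedCone ℝ Mat3 :=
  PointedCone.hull ℝ {ρ | ∃ (x : Fin 2 → ℂ) (y : Fin 2 × Fin 2 → ℂ),
    ρ = pureState fun p => x p.1 * y (p.2.1, p.2.2)}

/-- `β`: the convex cone of all unnormalized `B`-`CA` separable states. -/
noncomputable def betaCone : PointedCone ℝ Mat3 :=
  PointedCone.hull ℝ {ρ | ∃ (x : Fin 2 → ℂ) (y : Fin 2 × Fin 2 → ℂ),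
    ρ = pureState fun p => x p.2.1 * y (p.2.2, p.1)}

/-- `γ`: the convex cone of all unnormalized `C`-`AB` separable states. -/
noncomputable def gammaCone : PointedCone ℝ Mat3 :=
  PointedCone.hull ℝ {ρ | ∃ (x : Fin 2 → ℂ) (y : Fin 2 × Fin 2 → ℂ),
    ρ = pureState fun p => x p.2.2 * y (p.1, p.2.1)}

/-- The position of `(i, j, k)` in the lexicographic order. -/
def lexIndex (p : Qubits3) : Fin 8 := ⟨4 * p.1 + 2 * p.2.1 + p.2.2, by omega⟩

/-- The X-shaped matrix `X(a, b, z)`, written in the lexicographic order of the basis. -/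
noncomputable def xMatrix (a b : Fin 4 → ℝ) (z : Fin 4 → ℂ) : Mat3 :=
  (!![(a 0 : ℂ), 0, 0, 0, 0, 0, 0, z 0;
      0, (a 1 : ℂ), 0, 0, 0, 0, z 1, 0;
      0, 0, (a 2 : ℂ), 0, 0, z 2, 0, 0;
      0, 0, 0, (a 3 : ℂ), z 3, 0, 0, 0;
      0, 0, 0, conj (z 3), (b 3 : ℂ), 0, 0, 0;
      0, 0, conj (z 2), 0, 0, (b 2 : ℂ), 0, 0;
      0, conj (z 1), 0, 0, 0, 0, (b 1 : ℂ), 0;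
      conj (z 0), 0, 0, 0, 0, 0, 0, (b 0 : ℂ)] : Matrix (Fin 8) (Fin 8) ℂ).submatrix
    lexIndex lexIndex

/-- The GHZ diagonal matrix `X(a, a, z)` with `a, z ∈ ℝ⁴`. -/
noncomputable def ghzMatrix (a z : Fin 4 → ℝ) : Mat3 := xMatrix a a fun i => (z i : ℂ)

/-- The real vector space `V` of GHZ diagonal matrices. -/
noncomputable def ghzSpace : Submodule ℝ Mat3 where
  carrier := {W | ∃ a z : Fin 4 → ℝ, W = ghzMatrix a z}
  zero_mem' := ⟨0, 0, by
    ext p q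
    simp only [ghzMatrix, xMatrix, Matrix.submatrix_apply]
    generalize lexIndex p = i
    generalize lexIndex q = j
    fin_cases i <;> fin_cases j <;> simp⟩
  add_mem' := by
    rintro _ _ ⟨a, z, rfl⟩ ⟨a', z', rfl⟩
    refine ⟨a + a', z + z', ?_⟩
    ext p q
    simp only [ghzMatrix, xMatrix, Matrix.submatrix_apply, Matrix.add_apply]
    generalize lexIndex p = i
    generalize lexIndex q = j
    fin_cases i <;> fin_cases j <;> simp
  smul_mem' := by
    rintro c _ ⟨a, z, rfl⟩
    refine ⟨c • a, c • z, ?_⟩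
    ext p q
    simp only [ghzMatrix, xMatrix, Matrix.submatrix_apply, Matrix.smul_apply]
    generalize lexIndex p = i
    generalize lexIndex q = j
    fin_cases i <;> fin_cases j <;> simp

/-- The ray `{c ρ : c ≥ 0}`. -/
noncomputable def rayOf (ρ : Mat3) : PointedCone ℝ Mat3 := PointedCone.hull ℝ {ρ}

/-- The extreme rays of a convex cone `C`: the faces of `C` of the form `{c ρ : c ≥ 0}`, `ρ ≠ 0`. -/
def extremeRays (C : PointedCone ℝ Mat3) : Set (PointedCone ℝ Mat3) :=
  {R | (∃ ρ : Mat3, ρ ≠ 0 ∧ R = rayOf ρ) ∧ R.IsFaceOf C}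

/-- Symbols `(a, z)` with integer entries, denoting the GHZ diagonal matrices `X(a, a, z)`. -/
abbrev GHZSymbol : Type := (Fin 4 → ℤ) × (Fin 4 → ℤ)

/-- The GHZ diagonal matrix denoted by a symbol. -/
noncomputable def GHZSymbol.toMat (p : GHZSymbol) : Mat3 :=
  ghzMatrix (fun i => (p.1 i : ℝ)) (fun i => (p.2 i : ℝ))

/-- All symbols with upper row `a` and lower row `(±z₁, ±z₂, ±z₃, ±z₄)`, with independent signs. -/
def pmSymbols (a z : Fin 4 → ℤ) : Finset GHZSymbol :=
  {a} ×ˢ Fintype.piFinset fun i => {z i, -z i}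

/-- The diagonal states `Δ`. -/
def tableDelta : Finset GHZSymbol :=
  pmSymbols ![1, 0, 0, 0] ![0, 0, 0, 0] ∪ pmSymbols ![0, 1, 0, 0] ![0, 0, 0, 0] ∪
  pmSymbols ![0, 0, 1, 0] ![0, 0, 0, 0] ∪ pmSymbols ![0, 0, 0, 1] ![0, 0, 0, 0]

/-- The list for `α ∧ β ∧ γ`. -/
def tableABCMeet : Finset GHZSymbol :=
  tableDelta ∪ pmSymbols ![1, 1, 1, 1] ![1, 1, 1, 1]

/-- The list for `α ∧ β`. -/
def tableABMeet : Finset GHZSymbol :=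
  tableABCMeet ∪
  pmSymbols ![1, 0, 1, 1] ![1, 0, 0, 0] ∪ pmSymbols ![0, 1, 1, 1] ![0, 1, 0, 0] ∪
  pmSymbols ![1, 1, 1, 0] ![0, 0, 1, 0] ∪ pmSymbols ![1, 1, 0, 1] ![0, 0, 0, 1]

/-- The list for `(α ∧ β) ∨ (α ∧ γ)`. -/
def tableJoinOfMeets : Finset GHZSymbol :=
  tableABMeet ∪
  pmSymbols ![1, 1, 0, 1] ![1, 0, 0, 0] ∪ pmSymbols ![0, 1, 1, 1] ![0, 0, 1, 0] ∪
  pmSymbols ![1, 1, 1, 0] ![0, 1, 0, 0] ∪ pmSymbols ![1, 0, 1, 1] ![0, 0, 0, 1]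

/-- The list for `α ∧ (β ∨ γ)`. -/
def tableMeetJoin : Finset GHZSymbol :=
  tableJoinOfMeets ∪
  pmSymbols ![1, 2, 0, 1] ![1, 0, 0, 1] ∪ pmSymbols ![1, 0, 2, 1] ![1, 0, 0, 1] ∪
  pmSymbols ![2, 1, 1, 0] ![0, 1, 1, 0] ∪ pmSymbols ![0, 1, 1, 2] ![0, 1, 1, 0] ∪
  pmSymbols ![1, 2, 2, 1] ![1, 2, 0, 1] ∪ pmSymbols ![1, 2, 2, 1] ![1, 0, 2, 1] ∪
  pmSymbols ![2, 1, 1, 2] ![2, 1, 1, 0] ∪ pmSymbols ![2, 1, 1, 2] ![0, 1, 1, 2]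

/-- The list for `α`. -/
def tableA : Finset GHZSymbol :=
  tableDelta ∪ pmSymbols ![1, 0, 0, 1] ![1, 0, 0, 1] ∪ pmSymbols ![0, 1, 1, 0] ![0, 1, 1, 0]

/-- The list for `α ∨ (β ∧ γ)`. -/
def tableJoinMeet : Finset GHZSymbol :=
  tableA ∪
  pmSymbols ![1, 1, 1, 0] ![1, 0, 0, 0] ∪ pmSymbols ![0, 1, 1, 1] ![0, 0, 0, 1] ∪
  pmSymbols ![1, 1, 0, 1] ![0, 1, 0, 0] ∪ pmSymbols ![1, 0, 1, 1] ![0, 0, 1, 0]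

/-- The list for `(α ∨ β) ∧ (α ∨ γ)`. -/
def tableMeetOfJoins : Finset GHZSymbol :=
  tableJoinMeet ∪
  pmSymbols ![1, 1, 2, 0] ![1, 1, 0, 0] ∪ pmSymbols ![1, 2, 1, 0] ![1, 0, 1, 0] ∪
  pmSymbols ![2, 1, 0, 1] ![0, 1, 0, 1] ∪ pmSymbols ![2, 0, 1, 1] ![0, 0, 1, 1] ∪
  pmSymbols ![1, 1, 0, 2] ![1, 1, 0, 0] ∪ pmSymbols ![1, 0, 1, 2] ![1, 0, 1, 0] ∪
  pmSymbols ![0, 1, 2, 1] ![0, 1, 0, 1] ∪ pmSymbols ![0, 2, 1, 1] ![0, 0, 1, 1]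

/-- The list for `α ∨ β`. -/
def tableABJoin : Finset GHZSymbol :=
  tableDelta ∪
  pmSymbols ![1, 0, 0, 1] ![1, 0, 0, 1] ∪ pmSymbols ![0, 1, 1, 0] ![0, 1, 1, 0] ∪
  pmSymbols ![1, 0, 1, 0] ![1, 0, 1, 0] ∪ pmSymbols ![0, 1, 0, 1] ![0, 1, 0, 1]

/-- The list for `α ∨ β ∨ γ`. -/
def tableABCJoin : Finset GHZSymbol :=
  tableABJoin ∪ pmSymbols ![1, 1, 0, 0] ![1, 1, 0, 0] ∪ pmSymbols ![0, 0, 1, 1] ![0, 0, 1, 1]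

/-- The `n` symbols in `E` are exactly the extreme rays of `σ ∩ V`: `E` has `n` elements, and
`(a, z) ↦ {c X(a, a, z) : c ≥ 0}` is a bijection from `E` onto the set of extreme rays
of `σ ∩ V`. -/
def ListsGHZExtremeRays (σ : PointedCone ℝ Mat3) (E : Finset GHZSymbol) (n : ℕ) : Prop :=
  E.card = n ∧
  Set.BijOn (fun p : GHZSymbol => rayOf p.toMat) (E : Set GHZSymbol)
    (extremeRays (σ ⊓ PointedCone.ofSubmodule ghzSpace))

/-! The problem is first moved from 8×8 matrices to the coordinates `(a, z)` in `ℝ⁸`. `ghzMap`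
embeds the coordinates and `ghzProj` reads off the GHZ diagonal part, with `ghzProj ∘ ghzMap = id`.
A coordinate cone `K` represents `σ` when `K` embeds into `σ` and the whole of `σ` projects into
`K`; then `K` is exactly `σ ∩ V`. Both conditions are mere inclusions under linear maps, so they
survive sums and intersections (`Represents.inf`, `Represents.sup`). Hence only `α`, `β`, `γ` need
contact with quantum states. For them, projections of pure product states satisfy the bounds `|z j|
≤ a i` on paired columns (arithmetic-geometric mean inequality), and the nondiagonal generators are
averages of two product states.

What remains is polyhedral geometry in `ℝ⁸`. Joins are easy on generators and meets are easy on
inequalities, so the work lies in converting between the two. The inequalities hold on generators by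
a finite check. Conversely, a point satisfying them is decomposed explicitly into generators; since
the cones are closed under shrinking `|z|` and enlarging `a`, it suffices to dominate the point
(`DominatedBy.mem`), and permutations of the columns reduce the cases. The substantial
decompositions are `dominatedBy_repsABJoin`, `dominatedBy_repsMeetJoin` and
`dominatedBy_repsMeetOfJoins`.

Finally, an extreme ray of a finitely generated cone is spanned by a generator. Conversely, each
listed generator is exposed by a functional that is nonnegative on all generators and vanishes at no
other one. That functional is the sum of the inequalities tight at the generator, with the signs of
its anti-diagonal inserted. `AllExposed.slack_nonneg` reduces the check to one representative per
sign class, where it is decidable. -/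

/-! ### Cones closed under sign changes of the anti-diagonal. -/

/-- Coordinates `(a, z)` of the GHZ diagonal matrix `X(a, a, z)`. -/
abbrev GHZVec : Type := (Fin 4 → ℝ) × (Fin 4 → ℝ)

/-- The real vector denoted by a symbol. -/
def GHZSymbol.toVec (p : GHZSymbol) : GHZVec := (fun i => (p.1 i : ℝ), fun i => (p.2 i : ℝ))

/-- The cone generated by all sign changes of the symbols in `R`. -/
noncomputable def symCone (R : List GHZSymbol) : PointedCone ℝ GHZVec :=
  PointedCone.hull ℝ {v | ∃ r ∈ R, ∃ p ∈ pmSymbols r.1 r.2, v = p.toVec}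

theorem mem_pmSymbols {a z : Fin 4 → ℤ} {p : GHZSymbol} :
    p ∈ pmSymbols a z ↔ p.1 = a ∧ ∀ i, p.2 i = z i ∨ p.2 i = -z i := by
  obtain ⟨b, w⟩ := p
  simp [pmSymbols, eq_comm, and_comm]

theorem symCone_mono {R R' : List GHZSymbol} (h : R ⊆ R') : symCone R ≤ symCone R' :=
  Submodule.span_mono fun _ ⟨r, hr, p, hp, hv⟩ => ⟨r, h hr, p, hp, hv⟩

theorem symCone_append (R R' : List GHZSymbol) : symCone (R ++ R') = symCone R ⊔ symCone R' := by
  refine le_antisymm (Submodule.span_le.2 ?_)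
    (sup_le (symCone_mono (by simp)) (symCone_mono (by simp)))
  rintro _ ⟨r, hr, p, hp, rfl⟩
  rcases List.mem_append.1 hr with h | h
  · exact (le_sup_left : symCone R ≤ _) (Submodule.subset_span ⟨r, h, p, hp, rfl⟩)
  · exact (le_sup_right : symCone R' ≤ _) (Submodule.subset_span ⟨r, h, p, hp, rfl⟩)

/-! ### Cones given by inequalities -/

/-- Coefficients `(c, d)` of an inequality `∑ dᵢ |zᵢ| ≤ ∑ cᵢ aᵢ`. -/
abbrev Facet : Type := (Fin 4 → ℕ) × (Fin 4 → ℕ)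

/-- The cone of all `(a, z)` with `∑ dᵢ |zᵢ| ≤ ∑ cᵢ aᵢ` for all `(c, d)` in `F`. -/
def facetCone (F : List Facet) : PointedCone ℝ GHZVec where
  carrier := {x | ∀ g ∈ F, ∑ i, (g.2 i : ℝ) * |x.2 i| ≤ ∑ i, (g.1 i : ℝ) * x.1 i}
  zero_mem' := by intro g _; simp
  add_mem' := by
    intro x y hx hy g hg
    refine le_trans ?_ ((add_le_add (hx g hg) (hy g hg)).trans_eq ?_)
    · rw [← Finset.sum_add_distrib]
      refine Finset.sum_le_sum fun i _ => ?_
      rw [← mul_add]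
      exact mul_le_mul_of_nonneg_left (abs_add_le _ _) (Nat.cast_nonneg _)
    · rw [← Finset.sum_add_distrib]
      exact Finset.sum_congr rfl fun i _ => (mul_add _ _ _).symm
  smul_mem' := by
    intro c x hx g hg
    have h := mul_le_mul_of_nonneg_left (hx g hg) c.2
    rw [Finset.mul_sum, Finset.mul_sum] at h
    refine le_of_eq_of_le ?_ (h.trans_eq ?_)
    · refine Finset.sum_congr rfl fun i _ => ?_
      have : (c • x).2 i = (c : ℝ) * x.2 i := rfl
      rw [this, abs_mul, abs_of_nonneg c.2]; ring
    · refine Finset.sum_congr rfl fun i _ => ?_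
      have : (c • x).1 i = (c : ℝ) * x.1 i := rfl
      rw [this]; ring

theorem mem_facetCone {F : List Facet} {x : GHZVec} : x ∈ facetCone F ↔
    ∀ g ∈ F, ∑ i, (g.2 i : ℝ) * |x.2 i| ≤ ∑ i, (g.1 i : ℝ) * x.1 i := Iff.rfl

theorem facetCone_append (F F' : List Facet) :
    facetCone (F ++ F') = facetCone F ⊓ facetCone F' := by
  ext x
  simp only [Submodule.mem_inf, mem_facetCone, List.mem_append, or_imp, forall_and]

/-- The inequalities see only `|z|`, so one representative per sign class is enough, and the test is
a decidable statement about integers. -/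
theorem symCone_le_facetCone {R : List GHZSymbol} {F : List Facet}
    (h : ∀ r ∈ R, ∀ g ∈ F, ∑ i, (g.2 i : ℤ) * |r.2 i| ≤ ∑ i, (g.1 i : ℤ) * r.1 i) :
    symCone R ≤ facetCone F := by
  refine Submodule.span_le.2 ?_
  rintro _ ⟨r, hr, p, hp, rfl⟩ g hg
  obtain ⟨h1, h2⟩ := mem_pmSymbols.1 hp
  have habs : ∀ i, |p.2 i| = |r.2 i| := fun i => by rcases h2 i with h | h <;> simp [h]
  have := h r hr g hg
  simp only [← habs, ← h1] at this
  simp only [GHZSymbol.toVec]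
  exact_mod_cast this

/-! ### Decreasing the anti-diagonal -/

/-- The cone of all `(a, z)` such that `(a, θ z) ∈ S` for all `θ ∈ [-1, 1]⁴`. -/
def solidCore (S : PointedCone ℝ GHZVec) : PointedCone ℝ GHZVec where
  carrier := {x | ∀ θ : Fin 4 → ℝ, (∀ i, |θ i| ≤ 1) → (x.1, θ * x.2) ∈ S}
  zero_mem' := by
    intro θ _
    convert S.zero_mem
    simp
  add_mem' := by
    intro x y hx hy θ hθ
    convert S.add_mem (hx θ hθ) (hy θ hθ) using 1
    ext i <;> simp [mul_add]
  smul_mem' := by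
    intro c x hx θ hθ
    convert Submodule.smul_mem S c (hx θ hθ) using 1
    ext i
    · rfl
    · change θ i * ((c : ℝ) * x.2 i) = (c : ℝ) * (θ i * x.2 i)
      ring

/-- Shrinking the entries of the anti-diagonal moves it inside a box whose vertices are its sign
changes, and all of these are generators. -/
theorem toVec_mem_solidCore {R : List GHZSymbol} {r : GHZSymbol} (hr : r ∈ R) :
    r.toVec ∈ solidCore (symCone R) := by
  intro θ hθ
  have hbox : θ * r.toVec.2 ∈
      convexHull ℝ (Set.pi Set.univ fun i : Fin 4 => {(r.2 i : ℝ), -(r.2 i : ℝ)}) := by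
    rw [convexHull_pi]
    intro i _
    change _ ∈ convexHull ℝ {(r.2 i : ℝ), -(r.2 i : ℝ)}
    rw [convexHull_pair, segment_eq_image]
    obtain ⟨h1, h2⟩ := abs_le.1 (hθ i)
    -- On each axis, `θ r = ((1 + θ)/2) r + ((1 - θ)/2) (-r)`.
    exact ⟨(1 - θ i) / 2, ⟨by linarith, by linarith⟩, by simp [GHZSymbol.toVec]; ring⟩
  have hconv : Convex ℝ {w : Fin 4 → ℝ | (r.toVec.1, w) ∈ symCone R} := by
    intro v hv w hw s t hs ht hst
    have h := (symCone R).convex hv hw hs ht hst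
    change (r.toVec.1, s • v + t • w) ∈ symCone R
    have e : ((r.toVec.1, s • v + t • w) : GHZVec) = s • (r.toVec.1, v) + t • (r.toVec.1, w) := by
      refine Prod.ext ?_ rfl
      simp [← add_smul, hst]
    rw [e]
    exact h
  refine convexHull_min ?_ hconv hbox
  intro w hw
  have hw' : ∀ i, ∃ n : ℤ, (n = r.2 i ∨ n = -r.2 i) ∧ w i = n := by
    intro i
    rcases hw i trivial with h | h
    · exact ⟨_, Or.inl rfl, h⟩
    · exact ⟨_, Or.inr rfl, by simpa using h⟩
  choose n hn hwn using hw'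
  refine Submodule.subset_span ⟨r, hr, (r.1, n), mem_pmSymbols.2 ⟨rfl, hn⟩, ?_⟩
  ext i
  · rfl
  · exact hwn i

/-- The symbols of the diagonal states. -/
def diagReps : List GHZSymbol :=
  [(![1, 0, 0, 0], ![0, 0, 0, 0]), (![0, 1, 0, 0], ![0, 0, 0, 0]),
    (![0, 0, 1, 0], ![0, 0, 0, 0]), (![0, 0, 0, 1], ![0, 0, 0, 0])]

theorem diagonal_mem_symCone {b : Fin 4 → ℝ} (hb : 0 ≤ b) : (b, 0) ∈ symCone diagReps := by
  have key : ∀ r ∈ diagReps, r.toVec ∈ symCone diagReps := fun r hr =>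
    Submodule.subset_span ⟨r, hr, r, mem_pmSymbols.2 ⟨rfl, fun _ => Or.inl rfl⟩, rfl⟩
  simp only [diagReps, List.forall_mem_cons] at key
  obtain ⟨h0, h1, h2, h3, -⟩ := key
  have := add_mem (add_mem (add_mem (PointedCone.smul_mem _ (hb 0) h0)
    (PointedCone.smul_mem _ (hb 1) h1)) (PointedCone.smul_mem _ (hb 2) h2))
    (PointedCone.smul_mem _ (hb 3) h3)
  refine (congrArg (· ∈ symCone diagReps) ?_).mp this
  refine Prod.ext ?_ ?_ <;> funext i <;> fin_cases i <;> simp [GHZSymbol.toVec]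

/-- `(a, z)` is dominated by an element of `S` with smaller diagonal and larger anti-diagonal. -/
def DominatedBy (S : PointedCone ℝ GHZVec) (a z : Fin 4 → ℝ) : Prop :=
  ∃ y ∈ S, y.1 ≤ a ∧ z ≤ y.2

/-- The anti-diagonal of the dominating vector is shrunk to `x.2` inside the solid core, and the
leftover diagonal is added as a diagonal state. Thus decompositions only have to reach `|x.2|` from
above and `x.1` from below. -/
theorem DominatedBy.mem {R : List GHZSymbol} (hR : diagReps ⊆ R) {x : GHZVec}
    (h : DominatedBy (solidCore (symCone R)) x.1 |x.2|) : x ∈ symCone R := by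
  obtain ⟨y, hy, h1, h2⟩ := h
  have h3 : (y.1, x.2) ∈ symCone R := by
    -- Where `y.2 i = 0`, the quotient takes the default value `0`; this is harmless, since then
    -- `x.2 i = 0` too.
    have := hy (fun i => x.2 i / y.2 i) fun i => by
      rw [abs_div]
      exact div_le_one_of_le₀ ((h2 i).trans (le_abs_self _)) (abs_nonneg _)
    convert this using 2
    ext i
    have h4 : |x.2 i| ≤ y.2 i := h2 i
    by_cases h0 : y.2 i = 0
    · have : x.2 i = 0 := abs_nonpos_iff.1 (h0 ▸ h4)
      simp [h0, this]
    · simp [h0]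
  have h4 := add_mem h3 (symCone_mono hR (diagonal_mem_symCone (sub_nonneg.2 h1)))
  convert h4 using 1
  ext i <;> simp

/-! ### Column symmetries. -/

/-- Simultaneous permutation of the entries of `a` and `z`. -/
def permMap (π : Equiv.Perm (Fin 4)) : GHZVec →ₗ[ℝ] GHZVec where
  toFun x := (x.1 ∘ π, x.2 ∘ π)
  map_add' _ _ := rfl
  map_smul' _ _ := rfl

/-- Transports a decomposition along a relabelling of the columns: this yields the statements for
`β` and `γ` from those for `α`, and justifies the orderings of `z` assumed without loss of
generality. -/
theorem DominatedBy.perm {S : PointedCone ℝ GHZVec} (π : Equiv.Perm (Fin 4)) {a z : Fin 4 → ℝ}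
    (h : DominatedBy (S.comap (permMap π)) (a ∘ π.symm) (z ∘ π.symm)) : DominatedBy S a z := by
  obtain ⟨y, hy, h1, h2⟩ := h
  exact ⟨permMap π y, hy, fun i => (h1 (π i)).trans_eq (by simp),
    fun i => (h2 (π i)).trans_eq' (by simp)⟩

/-- Simultaneous permutation of the entries of a symbol. -/
def permSymbol (π : Equiv.Perm (Fin 4)) (r : GHZSymbol) : GHZSymbol := (r.1 ∘ π, r.2 ∘ π)

/-- `S` contains the vectors denoted by the symbols in `R`. -/
def ContainsReps (S : PointedCone ℝ GHZVec) (R : List GHZSymbol) : Prop := ∀ r ∈ R, r.toVec ∈ S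

theorem ContainsReps.perm {S : PointedCone ℝ GHZVec} {R R' : List GHZSymbol}
    (hS : ContainsReps S R) (π : Equiv.Perm (Fin 4)) (h : ∀ r ∈ R', permSymbol π r ∈ R) :
    ContainsReps (S.comap (permMap π)) R' :=
  fun r hr => hS _ (h r hr)

theorem ContainsReps.mono {S : PointedCone ℝ GHZVec} {R R' : List GHZSymbol}
    (hS : ContainsReps S R) (h : R' ⊆ R) : ContainsReps S R' := fun r hr => hS r (h hr)

theorem containsReps_solidCore (R : List GHZSymbol) : ContainsReps (solidCore (symCone R)) R :=
  fun _ => toVec_mem_solidCore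

/-! ### Representatives of the tables up to signs -/

/-- Representatives for `α`. -/
def repsA : List GHZSymbol :=
  diagReps ++
   [(![1, 0, 0, 1], ![1, 0, 0, 1]), (![0, 1, 1, 0], ![0, 1, 1, 0])]

/-- Representatives for `β`. -/
def repsB : List GHZSymbol :=
  diagReps ++
   [(![1, 0, 1, 0], ![1, 0, 1, 0]), (![0, 1, 0, 1], ![0, 1, 0, 1])]

/-- Representatives for `γ`. -/
def repsC : List GHZSymbol :=
  diagReps ++
   [(![1, 1, 0, 0], ![1, 1, 0, 0]), (![0, 0, 1, 1], ![0, 0, 1, 1])]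

/-- Representatives for `α ∧ β ∧ γ`. -/
def repsABC : List GHZSymbol :=
  diagReps ++
   [(![1, 1, 1, 1], ![1, 1, 1, 1])]

/-- Representatives for `α ∧ β`. -/
def repsAB : List GHZSymbol :=
  repsABC ++
   [(![1, 0, 1, 1], ![1, 0, 0, 0]), (![0, 1, 1, 1], ![0, 1, 0, 0]),
    (![1, 1, 1, 0], ![0, 0, 1, 0]), (![1, 1, 0, 1], ![0, 0, 0, 1])]

/-- Representatives for `α ∧ γ`. -/
def repsAC : List GHZSymbol :=
  repsABC ++
   [(![1, 1, 0, 1], ![1, 0, 0, 0]), (![0, 1, 1, 1], ![0, 0, 1, 0]),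
    (![1, 1, 1, 0], ![0, 1, 0, 0]), (![1, 0, 1, 1], ![0, 0, 0, 1])]

/-- Representatives for `β ∧ γ`. -/
def repsBC : List GHZSymbol :=
  repsABC ++
   [(![1, 1, 1, 0], ![1, 0, 0, 0]), (![0, 1, 1, 1], ![0, 0, 0, 1]),
    (![1, 1, 0, 1], ![0, 1, 0, 0]), (![1, 0, 1, 1], ![0, 0, 1, 0])]

/-- Representatives for `(α ∧ β) ∨ (α ∧ γ)`. -/
def repsJoinOfMeets : List GHZSymbol :=
  repsAB ++
   [(![1, 1, 0, 1], ![1, 0, 0, 0]), (![0, 1, 1, 1], ![0, 0, 1, 0]),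
    (![1, 1, 1, 0], ![0, 1, 0, 0]), (![1, 0, 1, 1], ![0, 0, 0, 1])]

/-- Representatives for `α ∧ (β ∨ γ)`. -/
def repsMeetJoin : List GHZSymbol :=
  repsJoinOfMeets ++
   [(![1, 2, 0, 1], ![1, 0, 0, 1]), (![1, 0, 2, 1], ![1, 0, 0, 1]),
    (![2, 1, 1, 0], ![0, 1, 1, 0]), (![0, 1, 1, 2], ![0, 1, 1, 0]),
    (![1, 2, 2, 1], ![1, 2, 0, 1]), (![1, 2, 2, 1], ![1, 0, 2, 1]),
    (![2, 1, 1, 2], ![2, 1, 1, 0]), (![2, 1, 1, 2], ![0, 1, 1, 2])]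

/-- Representatives for `α ∨ (β ∧ γ)`. -/
def repsJoinMeet : List GHZSymbol :=
  repsA ++
   [(![1, 1, 1, 0], ![1, 0, 0, 0]), (![0, 1, 1, 1], ![0, 0, 0, 1]),
    (![1, 1, 0, 1], ![0, 1, 0, 0]), (![1, 0, 1, 1], ![0, 0, 1, 0])]

/-- Representatives for `(α ∨ β) ∧ (α ∨ γ)`. -/
def repsMeetOfJoins : List GHZSymbol :=
  repsJoinMeet ++
   [(![1, 1, 2, 0], ![1, 1, 0, 0]), (![1, 2, 1, 0], ![1, 0, 1, 0]),
    (![2, 1, 0, 1], ![0, 1, 0, 1]), (![2, 0, 1, 1], ![0, 0, 1, 1]),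
    (![1, 1, 0, 2], ![1, 1, 0, 0]), (![1, 0, 1, 2], ![1, 0, 1, 0]),
    (![0, 1, 2, 1], ![0, 1, 0, 1]), (![0, 2, 1, 1], ![0, 0, 1, 1])]

/-- Representatives for `α ∨ β`. -/
def repsABJoin : List GHZSymbol :=
  repsA ++
   [(![1, 0, 1, 0], ![1, 0, 1, 0]), (![0, 1, 0, 1], ![0, 1, 0, 1])]

/-- Representatives for `α ∨ β ∨ γ`. -/
def repsABCJoin : List GHZSymbol :=
  repsABJoin ++
   [(![1, 1, 0, 0], ![1, 1, 0, 0]), (![0, 0, 1, 1], ![0, 0, 1, 1])]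


/-- Turns a list of weights and generators into a domination certificate, so that every
decomposition below becomes linear arithmetic in each column. -/
theorem ContainsReps.dominatedBy {S : PointedCone ℝ GHZVec} {R : List GHZSymbol}
    (hS : ContainsReps S R) (w : List ℝ) (R' : List GHZSymbol) {a z : Fin 4 → ℝ} (hR : R' ⊆ R)
    (hw : ∀ c ∈ w, 0 ≤ c)
    (ha : ∀ i, (List.zipWith (fun c r => c * (r.1 i : ℝ)) w R').sum ≤ a i)
    (hz : ∀ i, z i ≤ (List.zipWith (fun c r => c * (r.2 i : ℝ)) w R').sum) :
    DominatedBy S a z := by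
  have key : ∃ y ∈ S, (∀ i, y.1 i = (List.zipWith (fun c r => c * (r.1 i : ℝ)) w R').sum) ∧
      ∀ i, y.2 i = (List.zipWith (fun c r => c * (r.2 i : ℝ)) w R').sum := by
    clear ha hz
    induction w generalizing R' with
    | nil => exact ⟨0, S.zero_mem, by simp, by simp⟩
    | cons c w ih =>
      cases R' with
      | nil => exact ⟨0, S.zero_mem, by simp, by simp⟩
      | cons r R' =>
        obtain ⟨y, hy, h1, h2⟩ := ih R' (fun _ h => hR (List.mem_cons_of_mem _ h))
          fun _ h => hw _ (List.mem_cons_of_mem _ h)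
        refine ⟨c • r.toVec + y, S.add_mem (PointedCone.smul_mem _ (hw c (by simp))
          (hS r (hR (by simp)))) hy, fun i => ?_, fun i => ?_⟩
        · simp [h1, GHZSymbol.toVec]
        · simp [h2, GHZSymbol.toVec]
  obtain ⟨y, hy, h1, h2⟩ := key
  exact ⟨y, hy, fun i => (h1 i).trans_le (ha i), fun i => (hz i).trans_eq (h2 i).symm⟩

/-! ### Decompositions into the listed symbols -/

section Decompositions

variable {S : PointedCone ℝ GHZVec} {a z : Fin 4 → ℝ}

/-- Columns `0, 3` and columns `1, 2` decouple, and in each pair the maximum of the two `z` is a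
sufficient weight. -/
theorem dominatedBy_repsA (hS : ContainsReps S repsA) (hz : 0 ≤ z) (h00 : z 0 ≤ a 0)
    (h30 : z 3 ≤ a 0) (h03 : z 0 ≤ a 3) (h33 : z 3 ≤ a 3) (h11 : z 1 ≤ a 1)
    (h21 : z 2 ≤ a 1) (h12 : z 1 ≤ a 2) (h22 : z 2 ≤ a 2) : DominatedBy S a z := by
  have hz0 : 0 ≤ z 0 := hz 0
  have hz1 : 0 ≤ z 1 := hz 1
  obtain ⟨s, hs0, hs3, hsa0, hsa3⟩ : ∃ s, z 0 ≤ s ∧ z 3 ≤ s ∧ s ≤ a 0 ∧ s ≤ a 3 :=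
    ⟨max (z 0) (z 3), le_max_left _ _, le_max_right _ _, max_le h00 h30, max_le h03 h33⟩
  obtain ⟨t, ht1, ht2, hta1, hta2⟩ : ∃ t, z 1 ≤ t ∧ z 2 ≤ t ∧ t ≤ a 1 ∧ t ≤ a 2 :=
    ⟨max (z 1) (z 2), le_max_left _ _, le_max_right _ _, max_le h11 h21, max_le h12 h22⟩
  refine hS.dominatedBy [s, t]
    [(![1, 0, 0, 1], ![1, 0, 0, 1]), (![0, 1, 1, 0], ![0, 1, 1, 0])]
    (by decide) ?_ ?_ ?_
  · simp only [List.forall_mem_cons, List.not_mem_nil, false_imp_iff, implies_true, and_true]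
    refine ⟨?_, ?_⟩ <;> linarith
  · intro i; fin_cases i <;> simp <;> linarith
  · intro i; fin_cases i <;> simp <;> linarith

theorem dominatedBy_repsABC (hS : ContainsReps S repsABC) (hz : 0 ≤ z)
    (h : ∀ i j, z i ≤ a j) : DominatedBy S a z := by
  obtain ⟨m, hm⟩ := Finite.exists_max z
  have hw : 0 ≤ z m := hz m
  refine hS.dominatedBy [z m]
    [(![1, 1, 1, 1], ![1, 1, 1, 1])]
    (by decide) ?_ ?_ ?_
  · simpa using hw
  · intro i; fin_cases i <;> simp [h]
  · intro i; fin_cases i <;> simp [hm]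

/-- Each `a j` bounds every `z i` except one partner. If `z m` is the maximum and `s` the maximum of
the others, then the all-ones symbol with weight `s` fits everywhere, and the remainder `z m - s` is
carried by the generator that avoids the one column not known to bound `z m`. -/
theorem dominatedBy_repsAB (hS : ContainsReps S repsAB) (hz : 0 ≤ z) (h00 : z 0 ≤ a 0)
    (h02 : z 0 ≤ a 2) (h03 : z 0 ≤ a 3) (h11 : z 1 ≤ a 1) (h12 : z 1 ≤ a 2) (h13 : z 1 ≤ a 3)
    (h20 : z 2 ≤ a 0) (h21 : z 2 ≤ a 1) (h22 : z 2 ≤ a 2) (h30 : z 3 ≤ a 0) (h31 : z 3 ≤ a 1)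
    (h33 : z 3 ≤ a 3) : DominatedBy S a z := by
  have hz0 : 0 ≤ z 0 := hz 0
  have hz1 : 0 ≤ z 1 := hz 1
  have hz2 : 0 ≤ z 2 := hz 2
  have hz3 : 0 ≤ z 3 := hz 3
  obtain ⟨m, hm⟩ := Finite.exists_max z
  have hm0 := hm 0
  have hm1 := hm 1
  have hm2 := hm 2
  have hm3 := hm 3
  fin_cases m <;> simp only [Fin.zero_eta, Fin.mk_one, Fin.reduceFinMk] at hm0 hm1 hm2 hm3
  · obtain ⟨s, hs⟩ : ∃ s, s = max (z 1) (max (z 2) (z 3)) := ⟨_, rfl⟩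
    have hs1 : z 1 ≤ s := hs ▸ le_max_left _ _
    have hs2 : z 2 ≤ s := hs ▸ (le_max_left _ _).trans (le_max_right _ _)
    have hs3 : z 3 ≤ s := hs ▸ (le_max_right _ _).trans (le_max_right _ _)
    have hsm : s ≤ z 0 := hs ▸ max_le ‹_› (max_le ‹_› ‹_›)
    have hsa : s ≤ a 1 := hs ▸ max_le ‹_› (max_le ‹_› ‹_›)
    refine hS.dominatedBy [s, z 0 - s]
      [(![1, 1, 1, 1], ![1, 1, 1, 1]), (![1, 0, 1, 1], ![1, 0, 0, 0])]
      (by decide) ?_ ?_ ?_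
    · simp only [List.forall_mem_cons, List.not_mem_nil, false_imp_iff, implies_true, and_true]
      refine ⟨?_, ?_⟩ <;> linarith
    · intro i; fin_cases i <;> simp <;> linarith
    · intro i; fin_cases i <;> simp <;> linarith
  · obtain ⟨s, hs⟩ : ∃ s, s = max (z 0) (max (z 2) (z 3)) := ⟨_, rfl⟩
    have hs0 : z 0 ≤ s := hs ▸ le_max_left _ _
    have hs2 : z 2 ≤ s := hs ▸ (le_max_left _ _).trans (le_max_right _ _)
    have hs3 : z 3 ≤ s := hs ▸ (le_max_right _ _).trans (le_max_right _ _)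
    have hsm : s ≤ z 1 := hs ▸ max_le ‹_› (max_le ‹_› ‹_›)
    have hsa : s ≤ a 0 := hs ▸ max_le ‹_› (max_le ‹_› ‹_›)
    refine hS.dominatedBy [s, z 1 - s]
      [(![1, 1, 1, 1], ![1, 1, 1, 1]), (![0, 1, 1, 1], ![0, 1, 0, 0])]
      (by decide) ?_ ?_ ?_
    · simp only [List.forall_mem_cons, List.not_mem_nil, false_imp_iff, implies_true, and_true]
      refine ⟨?_, ?_⟩ <;> linarith
    · intro i; fin_cases i <;> simp <;> linarith
    · intro i; fin_cases i <;> simp <;> linarith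
  · obtain ⟨s, hs⟩ : ∃ s, s = max (z 0) (max (z 1) (z 3)) := ⟨_, rfl⟩
    have hs0 : z 0 ≤ s := hs ▸ le_max_left _ _
    have hs1 : z 1 ≤ s := hs ▸ (le_max_left _ _).trans (le_max_right _ _)
    have hs3 : z 3 ≤ s := hs ▸ (le_max_right _ _).trans (le_max_right _ _)
    have hsm : s ≤ z 2 := hs ▸ max_le ‹_› (max_le ‹_› ‹_›)
    have hsa : s ≤ a 3 := hs ▸ max_le ‹_› (max_le ‹_› ‹_›)
    refine hS.dominatedBy [s, z 2 - s]
      [(![1, 1, 1, 1], ![1, 1, 1, 1]), (![1, 1, 1, 0], ![0, 0, 1, 0])]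
      (by decide) ?_ ?_ ?_
    · simp only [List.forall_mem_cons, List.not_mem_nil, false_imp_iff, implies_true, and_true]
      refine ⟨?_, ?_⟩ <;> linarith
    · intro i; fin_cases i <;> simp <;> linarith
    · intro i; fin_cases i <;> simp <;> linarith
  · obtain ⟨s, hs⟩ : ∃ s, s = max (z 0) (max (z 1) (z 2)) := ⟨_, rfl⟩
    have hs0 : z 0 ≤ s := hs ▸ le_max_left _ _
    have hs1 : z 1 ≤ s := hs ▸ (le_max_left _ _).trans (le_max_right _ _)
    have hs2 : z 2 ≤ s := hs ▸ (le_max_right _ _).trans (le_max_right _ _)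
    have hsm : s ≤ z 3 := hs ▸ max_le ‹_› (max_le ‹_› ‹_›)
    have hsa : s ≤ a 2 := hs ▸ max_le ‹_› (max_le ‹_› ‹_›)
    refine hS.dominatedBy [s, z 3 - s]
      [(![1, 1, 1, 1], ![1, 1, 1, 1]), (![1, 1, 0, 1], ![0, 0, 0, 1])]
      (by decide) ?_ ?_ ?_
    · simp only [List.forall_mem_cons, List.not_mem_nil, false_imp_iff, implies_true, and_true]
      refine ⟨?_, ?_⟩ <;> linarith
    · intro i; fin_cases i <;> simp <;> linarith
    · intro i; fin_cases i <;> simp <;> linarith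

/-- This is a 2×2 transportation problem: the four pair generators join columns `{0, 1}` to columns
`{2, 3}`. Their weights form a nonnegative matrix whose row and column sums must lie between `z` and
`a`, with a common total `t`. The two sum inequalities are what makes such a `t` available. -/
theorem dominatedBy_repsABJoin (hS : ContainsReps S repsABJoin) (hz : 0 ≤ z)
    (h0 : z 0 ≤ a 0) (h1 : z 1 ≤ a 1) (h2 : z 2 ≤ a 2) (h3 : z 3 ≤ a 3)
    (h01 : z 0 + z 1 ≤ a 2 + a 3) (h23 : z 2 + z 3 ≤ a 0 + a 1) : DominatedBy S a z := by
  have hz0 : 0 ≤ z 0 := hz 0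
  have hz1 : 0 ≤ z 1 := hz 1
  have hz2 : 0 ≤ z 2 := hz 2
  have hz3 : 0 ≤ z 3 := hz 3
  obtain ⟨t, ht1, ht2, ht3, ht4⟩ : ∃ t, z 0 + z 1 ≤ t ∧ z 2 + z 3 ≤ t ∧ t ≤ a 0 + a 1 ∧
      t ≤ a 2 + a 3 :=
    ⟨max (z 0 + z 1) (z 2 + z 3), le_max_left _ _, le_max_right _ _,
      max_le (by linarith) h23, max_le h01 (by linarith)⟩
  obtain ⟨r, hr1, hr2, hr3, hr4⟩ : ∃ r, z 0 ≤ r ∧ r ≤ a 0 ∧ z 1 ≤ t - r ∧ t - r ≤ a 1 := by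
    refine ⟨min (a 0) (t - z 1), le_min h0 (by linarith), min_le_left _ _, ?_, ?_⟩
    · linarith [min_le_right (a 0) (t - z 1)]
    · rcases min_choice (a 0) (t - z 1) with h | h <;> rw [h] <;> linarith
  obtain ⟨c, hc1, hc2, hc3, hc4⟩ : ∃ c, z 2 ≤ c ∧ c ≤ a 2 ∧ z 3 ≤ t - c ∧ t - c ≤ a 3 := by
    refine ⟨min (a 2) (t - z 3), le_min h2 (by linarith), min_le_left _ _, ?_, ?_⟩
    · linarith [min_le_right (a 2) (t - z 3)]
    · rcases min_choice (a 2) (t - z 3) with h | h <;> rw [h] <;> linarith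
  -- With row sums `r, t - r` and column sums `c, t - c`, filling the entry joining columns `0` and
  -- `2` with `min r c` leaves the other three nonnegative.
  obtain ⟨l, hl1, hl2, hl3, hl4⟩ : ∃ l, 0 ≤ l ∧ l ≤ r ∧ l ≤ c ∧ r + c ≤ l + t := by
    refine ⟨min r c, le_min (by linarith) (by linarith), min_le_left _ _, min_le_right _ _, ?_⟩
    rcases min_choice r c with h | h <;> rw [h] <;> linarith
  refine hS.dominatedBy [r - l, c - l, l, l + t - r - c]
    [(![1, 0, 0, 1], ![1, 0, 0, 1]), (![0, 1, 1, 0], ![0, 1, 1, 0]),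
    (![1, 0, 1, 0], ![1, 0, 1, 0]), (![0, 1, 0, 1], ![0, 1, 0, 1])]
    (by decide) ?_ ?_ ?_
  · simp only [List.forall_mem_cons, List.not_mem_nil, false_imp_iff, implies_true, and_true]
    refine ⟨?_, ?_, ?_, ?_⟩ <;> linarith
  · intro i; fin_cases i <;> simp <;> linarith
  · intro i; fin_cases i <;> simp <;> linarith

/-- The normalized case in which `z 0` is the largest entry. All decompositions use exactly `z 0` in
diagonal columns `0` and `3`; the choice of generators only distributes the demand on columns `1`
and `2`. -/
theorem dominatedBy_repsMeetJoin_of_le (hS : ContainsReps S repsMeetJoin) (hz : 0 ≤ z)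
    (h00 : z 0 ≤ a 0) (h03 : z 0 ≤ a 3) (h11 : z 1 ≤ a 1) (h12 : z 1 ≤ a 2)
    (h0312 : z 0 + z 3 ≤ a 1 + a 2) (hz30 : z 3 ≤ z 0) (hz21 : z 2 ≤ z 1) (hz10 : z 1 ≤ z 0) :
    DominatedBy S a z := by
  have hz1 : 0 ≤ z 1 := hz 1
  have hz3 : 0 ≤ z 3 := hz 3
  rcases le_or_gt (z 0 + z 3) (2 * z 1) with h | h
  · refine hS.dominatedBy [2 * z 1 - z 0, z 0 - z 1]
      [(![1, 1, 1, 1], ![1, 1, 1, 1]), (![2, 1, 1, 2], ![2, 1, 1, 0])]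
      (by decide) ?_ ?_ ?_
    · simp only [List.forall_mem_cons, List.not_mem_nil, false_imp_iff, implies_true, and_true]
      refine ⟨?_, ?_⟩ <;> linarith
    · intro i; fin_cases i <;> simp <;> linarith
    · intro i; fin_cases i <;> simp <;> linarith
  -- After `z 1` is spent in each of columns `1` and `2`, an excess `z 0 + z 3 - 2 * z 1` remains:
  -- `u` of it is charged to column `1` and the rest to column `2`. `h0312` says that the two
  -- together have room.
  obtain ⟨u, hu0, hu1, hu2, hu3⟩ : ∃ u, 0 ≤ u ∧ u ≤ a 1 - z 1 ∧ u ≤ z 0 + z 3 - 2 * z 1 ∧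
      z 0 + z 3 - 2 * z 1 - u ≤ a 2 - z 1 := by
    refine ⟨min (a 1 - z 1) (z 0 + z 3 - 2 * z 1), le_min (by linarith) (by linarith),
      min_le_left _ _, min_le_right _ _, ?_⟩
    rcases min_choice (a 1 - z 1) (z 0 + z 3 - 2 * z 1) with h | h <;> rw [h] <;> linarith
  rcases le_or_gt (z 1) (z 3) with h13 | h13
  -- The charge `u` splits into `l`, carried by `1101`, and `u - l`, carried by `1201` at two units
  -- each; the bounds on `l` keep the complementary weights of `1011` and `1021` nonnegative.
  · obtain ⟨l, hl0, hl1, hl2, hl3⟩ : ∃ l, 0 ≤ l ∧ l ≤ u ∧ l ≤ z 0 - z 3 ∧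
        u - l ≤ 2 * (z 3 - z 1) := by
      refine ⟨min u (z 0 - z 3), le_min hu0 (by linarith), min_le_left _ _, min_le_right _ _, ?_⟩
      rcases min_choice u (z 0 - z 3) with h | h <;> rw [h] <;> linarith
    refine hS.dominatedBy [z 1, (u - l) / 2, z 3 - z 1 - (u - l) / 2, l, z 0 - z 3 - l]
      [(![1, 1, 1, 1], ![1, 1, 1, 1]), (![1, 2, 0, 1], ![1, 0, 0, 1]),
    (![1, 0, 2, 1], ![1, 0, 0, 1]), (![1, 1, 0, 1], ![1, 0, 0, 0]),
    (![1, 0, 1, 1], ![1, 0, 0, 0])]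
      (by decide) ?_ ?_ ?_
    · simp only [List.forall_mem_cons, List.not_mem_nil, false_imp_iff, implies_true, and_true]
      refine ⟨?_, ?_, ?_, ?_, ?_⟩ <;> linarith
    · intro i; fin_cases i <;> simp <;> linarith
    · intro i; fin_cases i <;> simp <;> linarith
  · refine hS.dominatedBy [z 3, z 1 - z 3, u, z 0 + z 3 - 2 * z 1 - u]
      [(![1, 1, 1, 1], ![1, 1, 1, 1]), (![2, 1, 1, 2], ![2, 1, 1, 0]),
    (![1, 1, 0, 1], ![1, 0, 0, 0]), (![1, 0, 1, 1], ![1, 0, 0, 0])]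
      (by decide) ?_ ?_ ?_
    · simp only [List.forall_mem_cons, List.not_mem_nil, false_imp_iff, implies_true, and_true]
      refine ⟨?_, ?_, ?_, ?_⟩ <;> linarith
    · intro i; fin_cases i <;> simp <;> linarith
    · intro i; fin_cases i <;> simp <;> linarith

/-- The inequalities are invariant under `(0 3)`, `(1 2)` and `(0 1)(2 3)`, which bring the largest
`z` to column `0`. -/
theorem dominatedBy_repsMeetJoin (hS : ContainsReps S repsMeetJoin) (hz : 0 ≤ z)
    (h00 : z 0 ≤ a 0) (h30 : z 3 ≤ a 0) (h03 : z 0 ≤ a 3) (h33 : z 3 ≤ a 3) (h11 : z 1 ≤ a 1)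
    (h21 : z 2 ≤ a 1) (h12 : z 1 ≤ a 2) (h22 : z 2 ≤ a 2) (h0312 : z 0 + z 3 ≤ a 1 + a 2)
    (h1203 : z 1 + z 2 ≤ a 0 + a 3) : DominatedBy S a z := by
  wlog hz30 : z 3 ≤ z 0 generalizing S a z
  · refine DominatedBy.perm (Equiv.swap 0 3)
      (this (hS.perm _ (by decide)) (fun i => hz ((Equiv.swap 0 3).symm i))
      h33 h03 h30 h00 h11 h21 h12 h22 ?_ ?_ (le_of_not_ge hz30))
    · exact (add_comm _ _).trans_le h0312
    · exact h1203.trans_eq (add_comm _ _)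
  wlog hz21 : z 2 ≤ z 1 generalizing S a z
  · refine DominatedBy.perm (Equiv.swap 1 2)
      (this (hS.perm _ (by decide)) (fun i => hz ((Equiv.swap 1 2).symm i))
      h00 h30 h03 h33 h22 h12 h21 h11 ?_ ?_ hz30 (le_of_not_ge hz21))
    · exact h0312.trans_eq (add_comm _ _)
    · exact (add_comm _ _).trans_le h1203
  rcases le_total (z 1) (z 0) with hz10 | hz10
  · exact dominatedBy_repsMeetJoin_of_le hS hz h00 h03 h11 h12 h0312 hz30 hz21 hz10
  · exact DominatedBy.perm ((Equiv.swap 0 1).trans (Equiv.swap 2 3)) (dominatedBy_repsMeetJoin_of_le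
      (hS.perm _ (by decide)) (fun i => hz (((Equiv.swap 0 1).trans (Equiv.swap 2 3)).symm i))
      h11 h12 h00 h03 h1203 hz21 hz30 hz10)

/-- A greedy use of column `3`: first `x` raises the weight of `1001`, which relieves columns `1`
and `2`; then `t` spends the remaining room on `1102` in place of `1120`. -/
theorem dominatedBy_repsMeetOfJoins_of_le (hS : ContainsReps S repsMeetOfJoins) (hz : 0 ≤ z)
    (h0 : z 0 ≤ a 0) (h1 : z 1 ≤ a 1) (h2 : z 2 ≤ a 2) (h3 : z 3 ≤ a 3)
    (h01 : z 0 + z 1 ≤ a 2 + a 3) (h02 : z 0 + z 2 ≤ a 1 + a 3)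
    (hz21 : z 2 ≤ z 1) (hz' : z 1 + z 3 ≤ z 0 + z 2) : DominatedBy S a z := by
  have hz2 : 0 ≤ z 2 := hz 2
  have hz3 : 0 ≤ z 3 := hz 3
  obtain ⟨p, hp⟩ : ∃ p, p = z 0 - z 3 := ⟨_, rfl⟩
  obtain ⟨q, hq⟩ : ∃ q, q = z 1 - z 2 := ⟨_, rfl⟩
  obtain ⟨x, hx0, hx1, hx2, hx3⟩ : ∃ x, 0 ≤ x ∧ x ≤ a 3 - z 3 ∧ x ≤ p - q ∧
      (x = a 3 - z 3 ∨ x = p - q) :=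
    ⟨min (a 3 - z 3) (p - q), le_min (by linarith) (by linarith), min_le_left _ _,
      min_le_right _ _, min_choice _ _⟩
  obtain ⟨t, ht0, ht1, ht2, ht3⟩ : ∃ t, 0 ≤ t ∧ t ≤ q ∧ t ≤ (a 3 - z 3 - x) / 2 ∧
      (t = q ∨ t = (a 3 - z 3 - x) / 2) :=
    ⟨min q ((a 3 - z 3 - x) / 2), le_min (by linarith) (by linarith), min_le_left _ _,
      min_le_right _ _, min_choice _ _⟩
  -- Each greedy choice stops either because the room in column `3` is exhausted, where a sum
  -- inequality applies, or because its own cap is reached, where the remaining demand is small.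
  have ha1 : z 2 + (p - q - x) + q ≤ a 1 := by rcases hx3 with h | h <;> linarith
  have ha2 : z 2 + (p - q - x) + 2 * (q - t) ≤ a 2 := by
    rcases hx3 with h | h <;> rcases ht3 with h' | h' <;> linarith
  refine hS.dominatedBy [z 3 + x, z 2, p - q - x, q - t, t]
    [(![1, 0, 0, 1], ![1, 0, 0, 1]), (![0, 1, 1, 0], ![0, 1, 1, 0]),
    (![1, 1, 1, 0], ![1, 0, 0, 0]), (![1, 1, 2, 0], ![1, 1, 0, 0]),
    (![1, 1, 0, 2], ![1, 1, 0, 0])]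
    (by decide) ?_ ?_ ?_
  · simp only [List.forall_mem_cons, List.not_mem_nil, false_imp_iff, implies_true, and_true]
    refine ⟨?_, ?_, ?_, ?_, ?_⟩ <;> linarith
  · intro i; fin_cases i <;> simp <;> linarith
  · intro i; fin_cases i <;> simp <;> linarith

theorem dominatedBy_repsMeetOfJoins (hS : ContainsReps S repsMeetOfJoins) (hz : 0 ≤ z)
    (h0 : z 0 ≤ a 0) (h1 : z 1 ≤ a 1) (h2 : z 2 ≤ a 2) (h3 : z 3 ≤ a 3)
    (h01 : z 0 + z 1 ≤ a 2 + a 3) (h23 : z 2 + z 3 ≤ a 0 + a 1) (h02 : z 0 + z 2 ≤ a 1 + a 3)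
    (h13 : z 1 + z 3 ≤ a 0 + a 2) : DominatedBy S a z := by
  wlog hz30 : z 3 ≤ z 0 generalizing S a z
  · refine DominatedBy.perm (Equiv.swap 0 3)
      (this (hS.perm _ (by decide)) (fun i => hz ((Equiv.swap 0 3).symm i))
      h3 h1 h2 h0 ?_ ?_ ?_ ?_ (le_of_not_ge hz30))
    · exact ((add_comm _ _).trans_le h13).trans_eq (add_comm _ _)
    · exact ((add_comm _ _).trans_le h02).trans_eq (add_comm _ _)
    · exact ((add_comm _ _).trans_le h23).trans_eq (add_comm _ _)
    · exact ((add_comm _ _).trans_le h01).trans_eq (add_comm _ _)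
  wlog hz21 : z 2 ≤ z 1 generalizing S a z
  · exact DominatedBy.perm (Equiv.swap 1 2)
      (this (hS.perm _ (by decide)) (fun i => hz ((Equiv.swap 1 2).symm i))
      h0 h2 h1 h3 h02 h13 h01 h23 hz30 (le_of_not_ge hz21))
  rcases le_total (z 1 + z 3) (z 0 + z 2) with hz' | hz'
  · exact dominatedBy_repsMeetOfJoins_of_le hS hz h0 h1 h2 h3 h01 h02 hz21 hz'
  · refine DominatedBy.perm ((Equiv.swap 0 1).trans (Equiv.swap 2 3))
      (dominatedBy_repsMeetOfJoins_of_le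
      (hS.perm _ (by decide)) (fun i => hz (((Equiv.swap 0 1).trans (Equiv.swap 2 3)).symm i))
      h1 h0 h3 h2 ?_ h13 hz30 hz')
    exact ((add_comm _ _).trans_le h01).trans_eq (add_comm _ _)

end Decompositions

/-! ### Inequalities -/

/-- Inequalities for `α`. -/
def facetsA : List Facet :=
  [(![1, 0, 0, 0], ![1, 0, 0, 0]), (![1, 0, 0, 0], ![0, 0, 0, 1]),
    (![0, 0, 0, 1], ![1, 0, 0, 0]), (![0, 0, 0, 1], ![0, 0, 0, 1]),
    (![0, 1, 0, 0], ![0, 1, 0, 0]), (![0, 1, 0, 0], ![0, 0, 1, 0]),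
    (![0, 0, 1, 0], ![0, 1, 0, 0]), (![0, 0, 1, 0], ![0, 0, 1, 0])]

/-- Inequalities for `β`. -/
def facetsB : List Facet :=
  [(![1, 0, 0, 0], ![1, 0, 0, 0]), (![1, 0, 0, 0], ![0, 0, 1, 0]),
    (![0, 0, 1, 0], ![1, 0, 0, 0]), (![0, 0, 1, 0], ![0, 0, 1, 0]),
    (![0, 1, 0, 0], ![0, 1, 0, 0]), (![0, 1, 0, 0], ![0, 0, 0, 1]),
    (![0, 0, 0, 1], ![0, 1, 0, 0]), (![0, 0, 0, 1], ![0, 0, 0, 1])]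

/-- Inequalities for `γ`. -/
def facetsC : List Facet :=
  [(![1, 0, 0, 0], ![1, 0, 0, 0]), (![1, 0, 0, 0], ![0, 1, 0, 0]),
    (![0, 1, 0, 0], ![1, 0, 0, 0]), (![0, 1, 0, 0], ![0, 1, 0, 0]),
    (![0, 0, 1, 0], ![0, 0, 1, 0]), (![0, 0, 1, 0], ![0, 0, 0, 1]),
    (![0, 0, 0, 1], ![0, 0, 1, 0]), (![0, 0, 0, 1], ![0, 0, 0, 1])]

/-- Inequalities for `α ∨ β`. -/
def facetsABJoin : List Facet :=
  [(![1, 0, 0, 0], ![1, 0, 0, 0]), (![0, 1, 0, 0], ![0, 1, 0, 0]),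
    (![0, 0, 1, 0], ![0, 0, 1, 0]), (![0, 0, 0, 1], ![0, 0, 0, 1]),
    (![0, 0, 1, 1], ![1, 1, 0, 0]), (![1, 1, 0, 0], ![0, 0, 1, 1])]

/-- Inequalities for `α ∨ γ`. -/
def facetsACJoin : List Facet :=
  [(![1, 0, 0, 0], ![1, 0, 0, 0]), (![0, 1, 0, 0], ![0, 1, 0, 0]),
    (![0, 0, 1, 0], ![0, 0, 1, 0]), (![0, 0, 0, 1], ![0, 0, 0, 1]),
    (![0, 1, 0, 1], ![1, 0, 1, 0]), (![1, 0, 1, 0], ![0, 1, 0, 1])]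

/-- Inequalities for `β ∨ γ`. -/
def facetsBCJoin : List Facet :=
  [(![1, 0, 0, 0], ![1, 0, 0, 0]), (![0, 1, 0, 0], ![0, 1, 0, 0]),
    (![0, 0, 1, 0], ![0, 0, 1, 0]), (![0, 0, 0, 1], ![0, 0, 0, 1]),
    (![0, 1, 1, 0], ![1, 0, 0, 1]), (![1, 0, 0, 1], ![0, 1, 1, 0])]

/-! ### Lattice operations on the three cones -/

/-- One inclusion is a finite check on generators, the other a decomposition; the identifications of
facet cones and meets below follow this pattern, with a column permutation where needed. -/
theorem facetCone_facetsA : facetCone facetsA = symCone repsA := by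
  refine le_antisymm (fun x hx => DominatedBy.mem (by decide) ?_) (symCone_le_facetCone (by decide))
  simp only [mem_facetCone, facetsA, List.forall_mem_cons] at hx
  simp [Fin.sum_univ_four] at hx
  obtain ⟨h00, h03, h30, h33, h11, h12, h21, h22⟩ := hx
  exact dominatedBy_repsA (containsReps_solidCore _) (fun _ => abs_nonneg _)
    h00 h03 h30 h33 h11 h12 h21 h22

theorem facetCone_facetsB : facetCone facetsB = symCone repsB := by
  refine le_antisymm (fun x hx => DominatedBy.mem (by decide) ?_) (symCone_le_facetCone (by decide))
  simp only [mem_facetCone, facetsB, List.forall_mem_cons] at hx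
  simp [Fin.sum_univ_four] at hx
  obtain ⟨h00, h02, h20, h22, h11, h13, h31, h33⟩ := hx
  exact DominatedBy.perm (Equiv.swap 2 3) (dominatedBy_repsA
    ((containsReps_solidCore _).perm _ (by decide))
      (fun _ => abs_nonneg _) h00 h02 h20 h22 h11 h13 h31 h33)

theorem facetCone_facetsC : facetCone facetsC = symCone repsC := by
  refine le_antisymm (fun x hx => DominatedBy.mem (by decide) ?_) (symCone_le_facetCone (by decide))
  simp only [mem_facetCone, facetsC, List.forall_mem_cons] at hx
  simp [Fin.sum_univ_four] at hx
  obtain ⟨h00, h01, h10, h11, h22, h23, h32, h33⟩ := hx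
  exact DominatedBy.perm (Equiv.swap 1 3) (dominatedBy_repsA
    ((containsReps_solidCore _).perm _ (by decide))
      (fun _ => abs_nonneg _) h00 h01 h10 h11 h33 h32 h23 h22)

theorem symCone_repsA_inf_repsB : symCone repsA ⊓ symCone repsB = symCone repsAB := by
  rw [← facetCone_facetsA, ← facetCone_facetsB, ← facetCone_append]
  refine le_antisymm (fun x hx => DominatedBy.mem (by decide) ?_) (symCone_le_facetCone (by decide))
  simp [mem_facetCone, facetsA, facetsB, Fin.sum_univ_four] at hx
  obtain ⟨h00, h03, h30, h33, h11, h12, h21, h22, h00, h02, h20, h22, h11, h13, h31, h33⟩ := hx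
  exact dominatedBy_repsAB (containsReps_solidCore _) (fun _ => abs_nonneg _)
    h00 h20 h30 h11 h21 h31 h02 h12 h22 h03 h13 h33

theorem symCone_repsA_inf_repsC : symCone repsA ⊓ symCone repsC = symCone repsAC := by
  rw [← facetCone_facetsA, ← facetCone_facetsC, ← facetCone_append]
  refine le_antisymm (fun x hx => DominatedBy.mem (by decide) ?_) (symCone_le_facetCone (by decide))
  simp [mem_facetCone, facetsA, facetsC, Fin.sum_univ_four] at hx
  obtain ⟨h00, h03, h30, h33, h11, h12, h21, h22, h00, h01, h10, h11, h22, h23, h32, h33⟩ := hx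
  exact DominatedBy.perm (Equiv.swap 1 2) (dominatedBy_repsAB
    ((containsReps_solidCore _).perm _ (by decide))
      (fun _ => abs_nonneg _) h00 h10 h30 h22 h12 h32 h01 h21 h11 h03 h23 h33)

theorem symCone_repsB_inf_repsC : symCone repsB ⊓ symCone repsC = symCone repsBC := by
  rw [← facetCone_facetsB, ← facetCone_facetsC, ← facetCone_append]
  refine le_antisymm (fun x hx => DominatedBy.mem (by decide) ?_) (symCone_le_facetCone (by decide))
  simp [mem_facetCone, facetsB, facetsC, Fin.sum_univ_four] at hx
  obtain ⟨h00, h02, h20, h22, h11, h13, h31, h33, h00, h01, h10, h11, h22, h23, h32, h33⟩ := hx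
  exact DominatedBy.perm (Equiv.swap 1 3) (dominatedBy_repsAB
    ((containsReps_solidCore _).perm _ (by decide))
      (fun _ => abs_nonneg _) h00 h20 h10 h33 h23 h13 h02 h32 h22 h01 h31 h11)

theorem symCone_repsA_inf_repsB_inf_repsC :
    symCone repsA ⊓ symCone repsB ⊓ symCone repsC = symCone repsABC := by
  rw [← facetCone_facetsA, ← facetCone_facetsB, ← facetCone_facetsC, ← facetCone_append,
    ← facetCone_append]
  refine le_antisymm (fun x hx => DominatedBy.mem (by decide) ?_) (symCone_le_facetCone (by decide))
  simp [mem_facetCone, facetsA, facetsB, facetsC, Fin.sum_univ_four] at hx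
  obtain ⟨h00, h03, h30, h33, h11, h12, h21, h22, h00, h02, h20, h22, h11, h13, h31, h33, h00,
    h01, h10, h11, h22, h23, h32, h33⟩ := hx
  refine dominatedBy_repsABC (containsReps_solidCore _) (fun _ => abs_nonneg _) fun i j => ?_
  fin_cases i <;> fin_cases j <;> assumption

theorem facetCone_facetsABJoin : facetCone facetsABJoin = symCone repsA ⊔ symCone repsB := by
  rw [← symCone_append]
  refine le_antisymm (fun x hx => DominatedBy.mem (by decide) ?_) (symCone_le_facetCone (by decide))
  simp [mem_facetCone, facetsABJoin, Fin.sum_univ_four] at hx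
  obtain ⟨h00, h11, h22, h33, h01, h23⟩ := hx
  exact dominatedBy_repsABJoin ((containsReps_solidCore _).mono (by decide))
    (fun _ => abs_nonneg _) h00 h11 h22 h33 h01 h23

theorem facetCone_facetsACJoin : facetCone facetsACJoin = symCone repsA ⊔ symCone repsC := by
  rw [← symCone_append]
  refine le_antisymm (fun x hx => DominatedBy.mem (by decide) ?_) (symCone_le_facetCone (by decide))
  simp [mem_facetCone, facetsACJoin, Fin.sum_univ_four] at hx
  obtain ⟨h00, h11, h22, h33, h01, h23⟩ := hx
  exact DominatedBy.perm (Equiv.swap 1 2) (dominatedBy_repsABJoin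
    ((containsReps_solidCore _).perm _ (by decide)) (fun _ => abs_nonneg _) h00 h22 h11 h33 h01 h23)

theorem facetCone_facetsBCJoin : facetCone facetsBCJoin = symCone repsB ⊔ symCone repsC := by
  rw [← symCone_append]
  refine le_antisymm (fun x hx => DominatedBy.mem (by decide) ?_) (symCone_le_facetCone (by decide))
  simp [mem_facetCone, facetsBCJoin, Fin.sum_univ_four] at hx
  obtain ⟨h00, h11, h22, h33, h01, h23⟩ := hx
  exact DominatedBy.perm (Equiv.swap 1 3) (dominatedBy_repsABJoin
    ((containsReps_solidCore _).perm _ (by decide)) (fun _ => abs_nonneg _) h00 h33 h22 h11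
    (h01.trans_eq (add_comm _ _)) ((add_comm _ _).trans_le h23))

theorem symCone_repsA_inf_sup : symCone repsA ⊓ (symCone repsB ⊔ symCone repsC) =
    symCone repsMeetJoin := by
  rw [← facetCone_facetsBCJoin, ← facetCone_facetsA, ← facetCone_append]
  refine le_antisymm (fun x hx => DominatedBy.mem (by decide) ?_) (symCone_le_facetCone (by decide))
  simp [mem_facetCone, facetsA, facetsBCJoin, Fin.sum_univ_four] at hx
  obtain ⟨h00, h03, h30, h33, h11, h12, h21, h22, -, -, -, -, hj1, hj2⟩ := hx
  exact dominatedBy_repsMeetJoin (containsReps_solidCore _) (fun _ => abs_nonneg _)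
    h00 h03 h30 h33 h11 h12 h21 h22 hj1 hj2

theorem symCone_repsA_sup_inf_sup :
    (symCone repsA ⊔ symCone repsB) ⊓ (symCone repsA ⊔ symCone repsC) =
      symCone repsMeetOfJoins := by
  rw [← facetCone_facetsABJoin, ← facetCone_facetsACJoin, ← facetCone_append]
  refine le_antisymm (fun x hx => DominatedBy.mem (by decide) ?_) (symCone_le_facetCone (by decide))
  simp [mem_facetCone, facetsABJoin, facetsACJoin, Fin.sum_univ_four] at hx
  obtain ⟨h00, h11, h22, h33, h01, h23, -, -, -, -, h02, h13⟩ := hx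
  exact dominatedBy_repsMeetOfJoins (containsReps_solidCore _) (fun _ => abs_nonneg _)
    h00 h11 h22 h33 h01 h23 h02 h13

theorem symCone_repsJoinOfMeets :
    (symCone repsA ⊓ symCone repsB) ⊔ (symCone repsA ⊓ symCone repsC) =
      symCone repsJoinOfMeets := by
  rw [symCone_repsA_inf_repsB, symCone_repsA_inf_repsC, ← symCone_append]
  exact le_antisymm (symCone_mono (by decide)) (symCone_mono (by decide))

theorem symCone_repsABJoin : symCone repsA ⊔ symCone repsB = symCone repsABJoin := by
  rw [← symCone_append]
  exact le_antisymm (symCone_mono (by decide)) (symCone_mono (by decide))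

theorem symCone_repsABCJoin :
    symCone repsA ⊔ symCone repsB ⊔ symCone repsC = symCone repsABCJoin := by
  rw [← symCone_append, ← symCone_append]
  exact le_antisymm (symCone_mono (by decide)) (symCone_mono (by decide))

/-- The generators of `β ∧ γ` include the all-ones symbol, which is redundant here: it belongs to
the triple meet and therefore to `α`. -/
theorem symCone_repsJoinMeet : symCone repsA ⊔ (symCone repsB ⊓ symCone repsC) =
    symCone repsJoinMeet := by
  have h : symCone repsABC ≤ symCone repsA := by
    rw [← symCone_repsA_inf_repsB_inf_repsC]
    exact inf_le_left.trans inf_le_left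
  refine le_antisymm (sup_le (symCone_mono (by decide)) ?_) ?_
  · rw [symCone_repsB_inf_repsC, repsBC, symCone_append]
    exact sup_le (h.trans (symCone_mono (by decide))) (symCone_mono (by decide))
  · rw [symCone_repsB_inf_repsC, ← symCone_append]
    exact symCone_mono (by decide)

/-! ### Twirling onto the GHZ diagonal matrices -/

theorem xMatrix_add (a b a' b' : Fin 4 → ℝ) (z z' : Fin 4 → ℂ) :
    xMatrix (a + a') (b + b') (z + z') = xMatrix a b z + xMatrix a' b' z' := by
  ext p q
  simp only [xMatrix, Matrix.submatrix_apply, Matrix.add_apply]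
  generalize lexIndex p = i
  generalize lexIndex q = j
  fin_cases i <;> fin_cases j <;> simp

theorem xMatrix_smul (c : ℝ) (a b : Fin 4 → ℝ) (z : Fin 4 → ℂ) :
    xMatrix (c • a) (c • b) (c • z) = c • xMatrix a b z := by
  ext p q
  simp only [xMatrix, Matrix.submatrix_apply, Matrix.smul_apply]
  generalize lexIndex p = i
  generalize lexIndex q = j
  fin_cases i <;> fin_cases j <;> simp

/-- The GHZ diagonal matrix with given coordinates. -/
noncomputable def ghzMap : GHZVec →ₗ[ℝ] Mat3 where
  toFun x := ghzMatrix x.1 x.2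
  map_add' x y := by
    rw [ghzMatrix, ghzMatrix, ghzMatrix, ← xMatrix_add]
    congr 1
    ext i
    simp
  map_smul' c x := by
    rw [ghzMatrix, ghzMatrix, RingHom.id_apply, ← xMatrix_smul]
    congr 1
    ext i
    simp

/-- The `i`-th basis label. -/
def topLabel : Fin 4 → Qubits3 := ![(0, 0, 0), (0, 0, 1), (0, 1, 0), (0, 1, 1)]

/-- The complement of the `i`-th basis label. -/
def botLabel : Fin 4 → Qubits3 := ![(1, 1, 1), (1, 1, 0), (1, 0, 1), (1, 0, 0)]

/-- The coordinates of the GHZ diagonal part of a matrix. -/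
noncomputable def ghzProj : Mat3 →ₗ[ℝ] GHZVec where
  toFun ρ := (fun i => ((ρ (topLabel i) (topLabel i)).re + (ρ (botLabel i) (botLabel i)).re) / 2,
    fun i => (ρ (topLabel i) (botLabel i)).re)
  map_add' ρ ρ' := by
    refine Prod.ext ?_ ?_ <;> funext i <;> simp
    ring
  map_smul' c ρ := by
    refine Prod.ext ?_ ?_ <;> funext i <;> simp
    ring

theorem ghzProj_ghzMap (x : GHZVec) : ghzProj (ghzMap x) = x := by
  refine Prod.ext ?_ ?_ <;> funext i <;> fin_cases i <;>
    simp [ghzProj, ghzMap, ghzMatrix, xMatrix, topLabel, botLabel, lexIndex]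

theorem ghzMap_injective : Function.Injective ghzMap :=
  Function.LeftInverse.injective ghzProj_ghzMap

/-- `K` consists of the coordinates of the GHZ diagonal matrices in `σ`, and also of the GHZ
diagonal parts of all matrices in `σ`. -/
structure Represents (σ : PointedCone ℝ Mat3) (K : PointedCone ℝ GHZVec) : Prop where
  map_le : K.map ghzMap ≤ σ
  proj_le : σ.map ghzProj ≤ K

namespace Represents

variable {σ τ : PointedCone ℝ Mat3} {K L : PointedCone ℝ GHZVec}

/-- A linear image of an intersection always lies in the intersection of the images, which is all
that either field requires. -/
theorem inf (h : Represents σ K) (h' : Represents τ L) : Represents (σ ⊓ τ) (K ⊓ L) where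
  map_le := le_inf ((Submodule.map_mono inf_le_left).trans h.map_le)
    ((Submodule.map_mono inf_le_right).trans h'.map_le)
  proj_le := le_inf ((Submodule.map_mono inf_le_left).trans h.proj_le)
    ((Submodule.map_mono inf_le_right).trans h'.proj_le)

theorem sup (h : Represents σ K) (h' : Represents τ L) : Represents (σ ⊔ τ) (K ⊔ L) where
  map_le := (Submodule.map_sup K L _).trans_le (sup_le_sup h.map_le h'.map_le)
  proj_le := (Submodule.map_sup σ τ _).trans_le (sup_le_sup h.proj_le h'.proj_le)

theorem inf_ghzSpace (h : Represents σ K) :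
    σ ⊓ PointedCone.ofSubmodule ghzSpace = K.map ghzMap := by
  refine le_antisymm ?_ (le_inf h.map_le ?_)
  · rintro _ ⟨hσ, a, z, rfl⟩
    refine ⟨(a, z), ?_, rfl⟩
    have := h.proj_le ⟨_, hσ, rfl⟩
    change ghzProj (ghzMap (a, z)) ∈ K at this
    rwa [ghzProj_ghzMap] at this
  · rintro _ ⟨x, -, rfl⟩
    exact ⟨x.1, x.2, rfl⟩

end Represents

/-! ### Pure product states and the three basic cones. -/

/-- The anti-diagonal entry is at most `|v (topLabel j)| |v (botLabel j)|` in absolute value; by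
hypothesis this equals the same product for `i`, and the arithmetic-geometric mean inequality bounds
it by the diagonal average. -/
theorem abs_ghzProj_pureState_le {v : Qubits3 → ℂ} {i j : Fin 4}
    (h : v (topLabel i) * v (botLabel i) = v (topLabel j) * v (botLabel j)) :
    |(ghzProj (pureState v)).2 j| ≤ (ghzProj (pureState v)).1 i := by
  have h1 : |(ghzProj (pureState v)).2 j| ≤ ‖v (topLabel i)‖ * ‖v (botLabel i)‖ := by
    rw [← norm_mul, h]
    refine (Complex.abs_re_le_norm _).trans_eq ?_
    simp [pureState, Matrix.vecMulVec_apply]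
  refine h1.trans ?_
  have h2 : (ghzProj (pureState v)).1 i = (‖v (topLabel i)‖ ^ 2 + ‖v (botLabel i)‖ ^ 2) / 2 := by
    simp [ghzProj, pureState, Matrix.vecMulVec_apply, ← Complex.normSq_eq_norm_sq,
      Complex.normSq_apply]
  rw [h2]
  nlinarith [sq_nonneg (‖v (topLabel i)‖ - ‖v (botLabel i)‖)]

/-- The vectors spanned by the basis labels in the rows `i` and `j`, with product coefficients. -/
noncomputable def rowVector (i j : Fin 4) (u w : ℂ) : Qubits3 → ℂ :=
  Pi.single (topLabel i) 1 + Pi.single (topLabel j) w + Pi.single (botLabel j) u +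
    Pi.single (botLabel i) (u * w)

theorem mul_pureState (v : Qubits3 → ℂ) (p q : Qubits3) : pureState v p q = v p * conj (v q) := by
  rfl

-- Replacing `(u, w)` by `(-u, -w)` fixes the coefficients in row `i` and negates those in row `j`.
-- The cross terms cancel in the sum, leaving an X-shaped matrix, whose anti-diagonal consists of
-- the real numbers `s` and `t`.
set_option maxHeartbeats 4000000 in
theorem pureState_rowVector_add {i j : Fin 4} (hij : i < j) {u w : ℂ} {s t : ℝ}
    (hu : u * conj u = 1) (hw : w * conj w = 1) (hs : u * w = s) (ht : w * conj u = t) :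
    pureState (rowVector i j u w) + pureState (rowVector i j (-u) (-w)) =
      (2 : ℝ) • ghzMatrix (Pi.single i 1 + Pi.single j 1) (Pi.single i s + Pi.single j t) := by
  have hs' : conj u * conj w = s := by simpa using congrArg conj hs
  have ht' : u * conj w = t := by
    have := congrArg conj ht
    simp only [map_mul, Complex.conj_conj, Complex.conj_ofReal] at this
    rw [mul_comm, this]
  ext ⟨p1, p2, p3⟩ ⟨q1, q2, q3⟩
  fin_cases i <;> fin_cases j <;> first | exact absurd hij (by decide) | skip
  all_goals
    fin_cases p1 <;> fin_cases p2 <;> fin_cases p3 <;> fin_cases q1 <;> fin_cases q2 <;>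
      fin_cases q3 <;>
      simp [mul_pureState, rowVector, topLabel, botLabel, ghzMatrix, xMatrix, lexIndex] <;>
      first
      | linear_combination 2 * hs
      | linear_combination 2 * ht
      | linear_combination 2 * hs'
      | linear_combination 2 * ht'
      | linear_combination 2 * hu
      | linear_combination 2 * hw
      | linear_combination 2 * (w * conj w) * hu + 2 * hw
      | norm_num

set_option maxHeartbeats 4000000 in
theorem pureState_single_add (i : Fin 4) :
    pureState (Pi.single (topLabel i) 1) + pureState (Pi.single (botLabel i) 1) =
      ghzMatrix (Pi.single i 1) 0 := by
  ext ⟨p1, p2, p3⟩ ⟨q1, q2, q3⟩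
  fin_cases i <;> fin_cases p1 <;> fin_cases p2 <;> fin_cases p3 <;> fin_cases q1 <;>
    fin_cases q2 <;> fin_cases q3 <;>
    simp [mul_pureState, topLabel, botLabel, ghzMatrix, xMatrix, lexIndex]

/-- The equations force `w ^ 2 = s * t`, so equal signs are reached with real phases and opposite
signs need the imaginary unit. -/
theorem exists_phases {s t : ℤ} (hs : s = 1 ∨ s = -1) (ht : t = 1 ∨ t = -1) :
    ∃ u w : ℂ, u * conj u = 1 ∧ w * conj w = 1 ∧ u * w = ((s : ℝ) : ℂ) ∧
      w * conj u = ((t : ℝ) : ℂ) := by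
  rcases hs with rfl | rfl <;> rcases ht with rfl | rfl
  · exact ⟨1, 1, by simp, by simp, by simp, by simp⟩
  · exact ⟨Complex.I, -Complex.I, by simp, by simp, by simp, by simp⟩
  · exact ⟨Complex.I, Complex.I, by simp, by simp, by simp, by simp⟩
  · exact ⟨1, -1, by simp, by simp, by simp, by simp⟩

/-- The symbol with entries `1` in the columns `i` and `j`. -/
def pairSymbol (i j : Fin 4) : GHZSymbol :=
  (Pi.single i 1 + Pi.single j 1, Pi.single i 1 + Pi.single j 1)

theorem toMat_mem_of_rowVector {σ : PointedCone ℝ Mat3} {i j : Fin 4} (hij : i < j)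
    (hσ : ∀ u w, pureState (rowVector i j u w) ∈ σ) {p : GHZSymbol}
    (hp : p ∈ pmSymbols (pairSymbol i j).1 (pairSymbol i j).2) : p.toMat ∈ σ := by
  obtain ⟨h1, h2⟩ := mem_pmSymbols.1 hp
  have hi := h2 i
  have hj := h2 j
  simp only [pairSymbol, Pi.add_apply, Pi.single_eq_same, Pi.single_eq_of_ne hij.ne,
    Pi.single_eq_of_ne hij.ne', add_zero, zero_add] at hi hj
  obtain ⟨u, w, hu, hw, hs, ht⟩ := exists_phases hi hj
  have h := PointedCone.smul_mem σ (r := (1 / 2 : ℝ)) (by norm_num)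
    (add_mem (hσ u w) (hσ (-u) (-w)))
  rw [pureState_rowVector_add hij hu hw hs ht, smul_smul, one_div_mul_cancel two_ne_zero,
    one_smul] at h
  suffices e : p.toMat = _ from e ▸ h
  refine congrArg₂ ghzMatrix (funext fun k => ?_) (funext fun k => ?_)
  · rw [h1]
    simp [pairSymbol, Pi.single_apply]
  · rcases eq_or_ne k i with rfl | hki
    · simp [hij.ne]
    rcases eq_or_ne k j with rfl | hkj
    · simp [hki]
    · have := h2 k
      simp [pairSymbol, hki, hkj] at this
      simp [this, hki, hkj]

theorem toMat_mem_of_single {σ : PointedCone ℝ Mat3}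
    (hσ : ∀ l, pureState (Pi.single l 1) ∈ σ) {r : GHZSymbol} (hr : r ∈ diagReps)
    {p : GHZSymbol} (hp : p ∈ pmSymbols r.1 r.2) : p.toMat ∈ σ := by
  obtain ⟨i, rfl⟩ : ∃ i, r = (Pi.single i 1, 0) := by
    have : ∀ r ∈ diagReps, ∃ i, r = (Pi.single i 1, 0) := by decide
    exact this r hr
  obtain ⟨h1, h2⟩ := mem_pmSymbols.1 hp
  have h := add_mem (hσ (topLabel i)) (hσ (botLabel i))
  rw [pureState_single_add] at h
  suffices e : p.toMat = _ from e ▸ h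
  refine congrArg₂ ghzMatrix (funext fun k => ?_) (funext fun k => ?_)
  · simp [h1, Pi.single_apply]
  · have := h2 k
    simp at this
    simp [this]

/-- The two halves of a representation use the two descriptions of the same cone: generators are
realized by product states, and projected product states are tested against inequalities. -/
theorem represents_of_generators {σ : PointedCone ℝ Mat3} {G : Set (Qubits3 → ℂ)}
    {i j k l : Fin 4} {F : List Facet} {R : List GHZSymbol} (hij : i < j) (hkl : k < l)
    (hσ : σ = PointedCone.hull ℝ (pureState '' G)) (hFR : facetCone F = symCone R)
    (hR : R = diagReps ++ [pairSymbol i j, pairSymbol k l])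
    (h1 : ∀ m, Pi.single m 1 ∈ G) (h2 : ∀ u w, rowVector i j u w ∈ G)
    (h3 : ∀ u w, rowVector k l u w ∈ G)
    (h4 : ∀ v ∈ G, ghzProj (pureState v) ∈ facetCone F) : Represents σ (symCone R) := by
  have hG : ∀ v ∈ G, pureState v ∈ σ := fun v hv => by
    rw [hσ]
    exact Submodule.subset_span ⟨v, hv, rfl⟩
  constructor
  · refine Submodule.map_le_iff_le_comap.2 (Submodule.span_le.2 ?_)
    rintro _ ⟨r, hr, p, hp, rfl⟩
    change p.toMat ∈ σ
    rw [hR, List.mem_append, List.mem_pair] at hr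
    rcases hr with hr | rfl | rfl
    · exact toMat_mem_of_single (fun m => hG _ (h1 m)) hr hp
    · exact toMat_mem_of_rowVector hij (fun u w => hG _ (h2 u w)) hp
    · exact toMat_mem_of_rowVector hkl (fun u w => hG _ (h3 u w)) hp
  · rw [← hFR, hσ]
    refine Submodule.map_le_iff_le_comap.2 (Submodule.span_le.2 ?_)
    rintro _ ⟨v, hv, rfl⟩
    exact h4 v hv

/-- Exchanging the `A`-entries of two complementary labels passes from column `0` to column `3`, or
from `1` to `2`. It preserves `v (topLabel i) * v (botLabel i)` for a product vector, which gives
the inequalities. -/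
theorem represents_alphaCone : Represents alphaCone (symCone repsA) := by
  refine represents_of_generators (G := {v | ∃ (x : Fin 2 → ℂ) (y : Fin 2 × Fin 2 → ℂ),
    v = fun p => x p.1 * y (p.2.1, p.2.2)}) (i := 0) (j := 3) (k := 1) (l := 2) (by decide)
    (by decide) ?_ facetCone_facetsA (by decide) ?_ ?_ ?_ ?_
  · rw [alphaCone]
    congr 1
    ext ρ
    simp [eq_comm]
  · rintro ⟨m1, m2, m3⟩
    refine ⟨Pi.single m1 1, Pi.single (m2, m3) 1, ?_⟩
    ext ⟨p1, p2, p3⟩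
    simp [Pi.single_apply, ite_and]
    grind
  · intro u w
    refine ⟨![1, u], Pi.single (0, 0) 1 + Pi.single (1, 1) w, ?_⟩
    ext ⟨p1, p2, p3⟩
    fin_cases p1 <;> fin_cases p2 <;> fin_cases p3 <;> simp [rowVector, topLabel, botLabel]
  · intro u w
    refine ⟨![1, u], Pi.single (0, 1) 1 + Pi.single (1, 0) w, ?_⟩
    ext ⟨p1, p2, p3⟩
    fin_cases p1 <;> fin_cases p2 <;> fin_cases p3 <;> simp [rowVector, topLabel, botLabel]
  · rintro _ ⟨x, y, rfl⟩
    simp only [mem_facetCone, facetsA, List.forall_mem_cons]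
    simp [Fin.sum_univ_four]
    refine ⟨?_, ?_, ?_, ?_, ?_, ?_, ?_, ?_⟩ <;> refine abs_ghzProj_pureState_le ?_ <;>
      simp [topLabel, botLabel] <;> ring

theorem represents_betaCone : Represents betaCone (symCone repsB) := by
  refine represents_of_generators (G := {v | ∃ (x : Fin 2 → ℂ) (y : Fin 2 × Fin 2 → ℂ),
    v = fun p => x p.2.1 * y (p.2.2, p.1)}) (i := 0) (j := 2) (k := 1) (l := 3) (by decide)
    (by decide) ?_ facetCone_facetsB (by decide) ?_ ?_ ?_ ?_
  · rw [betaCone]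
    congr 1
    ext ρ
    simp [eq_comm]
  · rintro ⟨m1, m2, m3⟩
    refine ⟨Pi.single m2 1, Pi.single (m3, m1) 1, ?_⟩
    ext ⟨p1, p2, p3⟩
    simp [Pi.single_apply, ite_and]
    grind
  · intro u w
    -- The roles of `u` and `w` are exchanged compared with `α`: here the two top labels, not
    -- `topLabel i` and `botLabel j`, differ in the distinguished qubit alone.
    refine ⟨![1, w], Pi.single (0, 0) 1 + Pi.single (1, 1) u, ?_⟩
    ext ⟨p1, p2, p3⟩
    fin_cases p1 <;> fin_cases p2 <;> fin_cases p3 <;>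
      simp [rowVector, topLabel, botLabel, mul_comm]
  · intro u w
    refine ⟨![1, w], Pi.single (1, 0) 1 + Pi.single (0, 1) u, ?_⟩
    ext ⟨p1, p2, p3⟩
    fin_cases p1 <;> fin_cases p2 <;> fin_cases p3 <;>
      simp [rowVector, topLabel, botLabel, mul_comm]
  · rintro _ ⟨x, y, rfl⟩
    simp only [mem_facetCone, facetsB, List.forall_mem_cons]
    simp [Fin.sum_univ_four]
    refine ⟨?_, ?_, ?_, ?_, ?_, ?_, ?_, ?_⟩ <;> refine abs_ghzProj_pureState_le ?_ <;>
      simp [topLabel, botLabel] <;> ring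

theorem represents_gammaCone : Represents gammaCone (symCone repsC) := by
  refine represents_of_generators (G := {v | ∃ (x : Fin 2 → ℂ) (y : Fin 2 × Fin 2 → ℂ),
    v = fun p => x p.2.2 * y (p.1, p.2.1)}) (i := 0) (j := 1) (k := 2) (l := 3) (by decide)
    (by decide) ?_ facetCone_facetsC (by decide) ?_ ?_ ?_ ?_
  · rw [gammaCone]
    congr 1
    ext ρ
    simp [eq_comm]
  · rintro ⟨m1, m2, m3⟩
    refine ⟨Pi.single m3 1, Pi.single (m1, m2) 1, ?_⟩
    ext ⟨p1, p2, p3⟩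
    simp [Pi.single_apply, ite_and]
  · intro u w
    refine ⟨![1, w], Pi.single (0, 0) 1 + Pi.single (1, 1) u, ?_⟩
    ext ⟨p1, p2, p3⟩
    fin_cases p1 <;> fin_cases p2 <;> fin_cases p3 <;>
      simp [rowVector, topLabel, botLabel, mul_comm]
  · intro u w
    refine ⟨![1, w], Pi.single (0, 1) 1 + Pi.single (1, 0) u, ?_⟩
    ext ⟨p1, p2, p3⟩
    fin_cases p1 <;> fin_cases p2 <;> fin_cases p3 <;>
      simp [rowVector, topLabel, botLabel, mul_comm]
  · rintro _ ⟨x, y, rfl⟩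
    simp only [mem_facetCone, facetsC, List.forall_mem_cons]
    simp [Fin.sum_univ_four]
    refine ⟨?_, ?_, ?_, ?_, ?_, ?_, ?_, ?_⟩ <;> refine abs_ghzProj_pureState_le ?_ <;>
      simp [topLabel, botLabel] <;> ring

/-! ### Extreme rays of finitely generated cones -/

section Faces

variable {M : Type*} [AddCommGroup M] [Module ℝ M]

/-- Nonnegativity passes from the generators to the cone, and a nonnegative combination on which `φ`
vanishes can only involve `v`. So the ray is the exposed face of `φ`. -/
theorem PointedCone.isFaceOf_hull_singleton {s : Set M} {v : M} (hv : v ∈ s) (φ : M →ₗ[ℝ] ℝ)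
    (hφv : φ v = 0) (hφ : ∀ w ∈ s, 0 ≤ φ w ∧ (φ w = 0 → w = v)) :
    (PointedCone.hull ℝ {v}).IsFaceOf (PointedCone.hull ℝ s) := by
  have key : ∀ x ∈ PointedCone.hull ℝ s, 0 ≤ φ x ∧ (φ x = 0 → x ∈ PointedCone.hull ℝ {v}) := by
    intro x hx
    induction hx using Submodule.span_induction with
    | mem x hx =>
      refine ⟨(hφ x hx).1, fun h => ?_⟩
      rw [(hφ x hx).2 h]
      exact Submodule.mem_span_singleton_self v
    | zero => exact ⟨by simp, fun _ => zero_mem _⟩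
    | add x y _ _ hx hy =>
      rw [map_add]
      refine ⟨add_nonneg hx.1 hy.1, fun h => ?_⟩
      obtain ⟨h1, h2⟩ := (add_eq_zero_iff_of_nonneg hx.1 hy.1).1 h
      exact add_mem (hx.2 h1) (hy.2 h2)
    | smul c x _ hx =>
      have h0 : φ (c • x) = (c : ℝ) * φ x := map_smul φ (c : ℝ) x
      rw [h0]
      refine ⟨mul_nonneg c.2 hx.1, fun h => ?_⟩
      rcases mul_eq_zero.1 h with h | h
      · have : c = 0 := Subtype.ext h
        rw [this, zero_smul]
        exact zero_mem _
      · exact Submodule.smul_mem _ _ (hx.2 h)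
  refine ⟨Submodule.span_mono (Set.singleton_subset_iff.2 hv), fun {x y a} hx hy ha h => ?_⟩
  have h0 : φ (a • x + y) = 0 := by
    obtain ⟨c, hc⟩ := Submodule.mem_span_singleton.1 h
    rw [← hc]
    exact (map_smul φ (c : ℝ) v).trans (by simp [hφv])
  have hx' := key x hx
  have hy' := (key y hy).1
  rw [map_add, map_smul, smul_eq_mul] at h0
  refine hx'.2 (le_antisymm ?_ hx'.1)
  by_contra! hpos
  have := mul_pos ha hpos
  linarith

/-- Any expression of a point of a face by generators uses, with positive coefficients, only
generators in that face. -/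
theorem PointedCone.IsFaceOf.le_hull_inter {s : Set M} {F : PointedCone ℝ M}
    (hF : F.IsFaceOf (PointedCone.hull ℝ s)) : F ≤ PointedCone.hull ℝ (s ∩ F) := by
  intro x hxF
  have hx := hF.le hxF
  induction hx using Submodule.span_induction with
  | mem x hx => exact Submodule.subset_span ⟨hx, hxF⟩
  | zero => exact zero_mem _
  | add x y hx' hy' hx hy =>
    exact add_mem (hx (hF.mem_of_add_mem_left hx' hy' hxF))
      (hy (hF.mem_of_add_mem_right hx' hy' hxF))
  | smul c x hx' hx =>
    rcases eq_or_lt_of_le (show (0 : ℝ) ≤ c from c.2) with h | h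
    · have : c = 0 := Subtype.ext h.symm
      rw [this, zero_smul]
      exact zero_mem _
    · refine Submodule.smul_mem _ _ (hx (hF.mem_of_smul_add_mem hx' (zero_mem _) h ?_))
      rw [add_zero]
      exact hxF

theorem PointedCone.IsFaceOf.exists_hull_singleton_eq {s : Set M} {v : M} (hv : v ≠ 0)
    (hF : (PointedCone.hull ℝ {v}).IsFaceOf (PointedCone.hull ℝ s)) :
    ∃ w ∈ s, PointedCone.hull ℝ {w} = PointedCone.hull ℝ {v} := by
  obtain ⟨w, ⟨hws, hwF⟩, hw0⟩ : ∃ w ∈ s ∩ PointedCone.hull ℝ {v}, w ≠ 0 := by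
    by_contra! h
    have h1 := hF.le_hull_inter (Submodule.mem_span_singleton_self v)
    have h2 : PointedCone.hull ℝ (s ∩ (PointedCone.hull ℝ {v} : PointedCone ℝ M)) = ⊥ :=
      Submodule.span_eq_bot.2 h
    rw [h2] at h1
    exact hv ((Submodule.mem_bot _).1 h1)
  refine ⟨w, hws, le_antisymm (Submodule.span_le.2 (Set.singleton_subset_iff.2 hwF))
    (Submodule.span_le.2 (Set.singleton_subset_iff.2 ?_))⟩
  obtain ⟨c, rfl⟩ := Submodule.mem_span_singleton.1 hwF
  have hc : (c : ℝ) ≠ 0 := fun h => hw0 (by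
    have : c = 0 := Subtype.ext h
    rw [this, zero_smul])
  have h := PointedCone.smul_mem (PointedCone.hull ℝ {c • v}) (inv_nonneg.2 c.2)
    (Submodule.mem_span_singleton_self _)
  have e : (c : ℝ)⁻¹ • c • v = v := inv_smul_smul₀ hc v
  rwa [e] at h

end Faces

/-! ### Exposing functionals -/

/-- The value at `q` of the inequality `g`, with the signs of the anti-diagonal of `p`. -/
def slack (g : Facet) (p q : GHZSymbol) : ℤ :=
  ∑ i, ((g.1 i : ℤ) * q.1 i - (g.2 i : ℤ) * (Int.sign (p.2 i) * q.2 i))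

/-- The sum of the inequalities in `F` that are tight at `p`. -/
def tightSum (F : List Facet) (p : GHZSymbol) : Facet :=
  (F.filter fun g => slack g p p = 0).sum

/-- The symbols in `R` have nonnegative entries and are exposed by the sums of the inequalities
in `F` that are tight at them. -/
def AllExposed (R : List GHZSymbol) (F : List Facet) : Prop :=
  ∀ p ∈ R, p.1 ≠ 0 ∧ (∀ i, 0 ≤ p.2 i) ∧ slack (tightSum F p) p p = 0 ∧
    (∀ i, p.2 i ≠ 0 → 0 < (tightSum F p).2 i) ∧
    ∀ q ∈ R, 0 ≤ slack (tightSum F p) p q ∧ (slack (tightSum F p) p q = 0 → q = p)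

instance (R : List GHZSymbol) (F : List Facet) : Decidable (AllExposed R F) := by
  unfold AllExposed
  infer_instance

theorem sign_mul_le_sign_mul {a b x y : ℤ} (ha : 0 ≤ a) (hb : 0 ≤ b) (hx : x = a ∨ x = -a)
    (hy : y = b ∨ y = -b) : Int.sign x * y ≤ Int.sign a * b := by
  rcases ha.eq_or_lt with rfl | ha
  · have : x = 0 := by omega
    simp [this]
  · rw [Int.sign_eq_one_of_pos ha]
    have hx' : Int.sign x = 1 ∨ Int.sign x = -1 := by
      rcases hx with rfl | rfl
      · exact Or.inl (Int.sign_eq_one_of_pos ha)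
      · exact Or.inr (Int.sign_eq_neg_one_of_neg (by omega))
    rcases hx' with h | h <;> rw [h] <;> omega

theorem eq_of_sign_mul_eq {a x y : ℤ} (ha : 0 < a) (hx : x = a ∨ x = -a) (hy : y = a ∨ y = -a)
    (h : Int.sign x * y = Int.sign a * a) : y = x := by
  rw [Int.sign_eq_one_of_pos ha] at h
  rcases hx with rfl | rfl
  · rw [Int.sign_eq_one_of_pos ha] at h
    omega
  · rw [Int.sign_eq_neg_one_of_neg (by omega)] at h
    omega

/-- Changing signs can only increase the slack over its value at the representatives. If the slack
vanishes, the representatives coincide and equality holds term by term; positive coefficients at the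
nonzero entries of `z` then force equal signs. -/
theorem AllExposed.slack_nonneg {R : List GHZSymbol} {F : List Facet} (h : AllExposed R F)
    {p q P Q : GHZSymbol} (hp : p ∈ R) (hq : q ∈ R) (hP : P ∈ pmSymbols p.1 p.2)
    (hQ : Q ∈ pmSymbols q.1 q.2) :
    0 ≤ slack (tightSum F p) P Q ∧ (slack (tightSum F p) P Q = 0 → Q = P) := by
  obtain ⟨-, hp0, -, hpos, hpq⟩ := h p hp
  obtain ⟨-, hq0, -⟩ := h q hq
  obtain ⟨h1, h2⟩ := hpq q hq
  obtain ⟨hP1, hP2⟩ := mem_pmSymbols.1 hP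
  obtain ⟨hQ1, hQ2⟩ := mem_pmSymbols.1 hQ
  have hterm : ∀ i ∈ Finset.univ, ((tightSum F p).1 i : ℤ) * q.1 i -
      ((tightSum F p).2 i : ℤ) * (Int.sign (p.2 i) * q.2 i) ≤
      ((tightSum F p).1 i : ℤ) * Q.1 i -
      ((tightSum F p).2 i : ℤ) * (Int.sign (P.2 i) * Q.2 i) := fun i _ => by
    rw [hQ1]
    exact sub_le_sub_left (mul_le_mul_of_nonneg_left
      (sign_mul_le_sign_mul (hp0 i) (hq0 i) (hP2 i) (hQ2 i)) (Int.natCast_nonneg _)) _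
  have hle : slack (tightSum F p) p q ≤ slack (tightSum F p) P Q := Finset.sum_le_sum hterm
  refine ⟨h1.trans hle, fun h0 => ?_⟩
  have hpq0 : slack (tightSum F p) p q = 0 := le_antisymm (h0 ▸ hle) h1
  obtain rfl := h2 hpq0
  have heq := (Finset.sum_eq_sum_iff_of_le hterm).1 (hpq0.trans h0.symm)
  refine Prod.ext (hQ1.trans hP1.symm) (funext fun i => ?_)
  rcases (hp0 i).eq_or_lt with hi | hi
  · have a1 := hP2 i
    have a2 := hQ2 i
    omega
  · have := heq i (Finset.mem_univ i)
    rw [hQ1, sub_right_inj] at this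
    have hne : ((tightSum F q).2 i : ℤ) ≠ 0 := by exact_mod_cast (hpos i hi.ne').ne'
    exact eq_of_sign_mul_eq hi (hP2 i) (hQ2 i) (mul_left_cancel₀ hne this).symm

theorem AllExposed.slack_self {R : List GHZSymbol} {F : List Facet} (h : AllExposed R F)
    {p P : GHZSymbol} (hp : p ∈ R) (hP : P ∈ pmSymbols p.1 p.2) :
    slack (tightSum F p) P P = 0 := by
  obtain ⟨-, hp0, hs, -⟩ := h p hp
  obtain ⟨hP1, hP2⟩ := mem_pmSymbols.1 hP
  rw [← hs, slack, slack]
  refine Finset.sum_congr rfl fun i _ => ?_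
  rw [hP1, Int.sign_mul_self_eq_abs, Int.sign_mul_self_eq_abs]
  rcases hP2 i with h | h <;> simp [h]

/-- The linear functional whose values on symbols are `slack g p`. -/
noncomputable def slackFunctional (g : Facet) (p : GHZSymbol) : GHZVec →ₗ[ℝ] ℝ where
  toFun x := ∑ i, ((g.1 i : ℝ) * x.1 i - (g.2 i : ℝ) * ((Int.sign (p.2 i) : ℤ) * x.2 i))
  map_add' x y := by
    rw [← Finset.sum_add_distrib]
    refine Finset.sum_congr rfl fun i _ => ?_
    simp only [Prod.fst_add, Prod.snd_add, Pi.add_apply]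
    ring
  map_smul' c x := by
    rw [smul_eq_mul, Finset.mul_sum]
    refine Finset.sum_congr rfl fun i _ => ?_
    simp only [Prod.smul_fst, Prod.smul_snd, Pi.smul_apply, smul_eq_mul, RingHom.id_apply]
    ring

theorem slackFunctional_toVec (g : Facet) (p q : GHZSymbol) :
    slackFunctional g p q.toVec = slack g p q := by
  simp [slackFunctional, slack, GHZSymbol.toVec]

theorem map_hull_toVec (p : GHZSymbol) :
    (PointedCone.hull ℝ {p.toVec}).map ghzMap = rayOf p.toMat :=
  (Submodule.map_span _ _).trans (by rw [Set.image_singleton]; rfl)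

/-- The functional attached to `P` does triple duty: it exposes the ray of `P`, separates `P` from
every other symbol, and so shows that no two symbols span the same ray. Surjectivity needs only that
an extreme ray contains a generator. -/
theorem Represents.listsGHZExtremeRays {σ : PointedCone ℝ Mat3} {R : List GHZSymbol}
    (hσ : Represents σ (symCone R)) {F : List Facet} (hF : AllExposed R F)
    {E : Finset GHZSymbol} (hE : ∀ p, p ∈ E ↔ ∃ r ∈ R, p ∈ pmSymbols r.1 r.2) {n : ℕ}
    (hn : E.card = n) : ListsGHZExtremeRays σ E n := by
  have hgen : symCone R = PointedCone.hull ℝ (GHZSymbol.toVec '' E) := by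
    rw [symCone]
    congr 1
    ext v
    simp only [Set.mem_ofPred_eq, Set.mem_image, Finset.mem_coe, hE]
    constructor
    · rintro ⟨r, hr, p, hp, rfl⟩
      exact ⟨p, ⟨r, hr, hp⟩, rfl⟩
    · rintro ⟨p, ⟨r, hr, hp⟩, rfl⟩
      exact ⟨r, hr, p, hp, rfl⟩
  refine ⟨hn, ?_⟩
  rw [hσ.inf_ghzSpace]
  refine ⟨fun P hP => ⟨⟨P.toMat, fun h0 => ?_, rfl⟩, ?_⟩, fun P hP Q hQ hPQ => ?_, ?_⟩
  · obtain ⟨r, hr, hPr⟩ := (hE P).1 hP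
    refine (hF r hr).1 (funext fun i => ?_)
    have h1 : P.toVec = 0 := ghzMap_injective (h0.trans (map_zero ghzMap).symm)
    have h2 := congrFun (congrArg Prod.fst h1) i
    rw [← (mem_pmSymbols.1 hPr).1]
    exact Int.cast_eq_zero.1 h2
  · obtain ⟨r, hr, hPr⟩ := (hE P).1 hP
    change (rayOf P.toMat).IsFaceOf _
    rw [← map_hull_toVec, hgen]
    -- An injective linear map carries faces to faces, so exposure can be verified in coordinates.
    refine PointedCone.IsFaceOf.map _ ghzMap_injective
      (PointedCone.isFaceOf_hull_singleton ⟨P, hP, rfl⟩ (slackFunctional (tightSum F r) P) ?_ ?_)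
    · rw [slackFunctional_toVec, hF.slack_self hr hPr, Int.cast_zero]
    · rintro _ ⟨Q, hQ, rfl⟩
      obtain ⟨q, hq, hQq⟩ := (hE Q).1 hQ
      obtain ⟨h1, h2⟩ := hF.slack_nonneg hr hq hPr hQq
      rw [slackFunctional_toVec]
      exact ⟨Int.cast_nonneg h1, fun h => congrArg _ (h2 (Int.cast_eq_zero.1 h))⟩
  · obtain ⟨r, hr, hPr⟩ := (hE P).1 hP
    obtain ⟨q, hq, hQq⟩ := (hE Q).1 hQ
    have hmem : Q.toMat ∈ rayOf P.toMat := by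
      change rayOf P.toMat = rayOf Q.toMat at hPQ
      rw [hPQ]
      exact Submodule.mem_span_singleton_self _
    rw [← map_hull_toVec] at hmem
    obtain ⟨x, hx, hxQ⟩ := hmem
    obtain rfl : x = Q.toVec := ghzMap_injective hxQ
    obtain ⟨c, hc⟩ := Submodule.mem_span_singleton.1 hx
    -- `Q` lies on the ray of `P`, where the exposing functional of `P` vanishes.
    have h0 : slackFunctional (tightSum F r) P Q.toVec = 0 := by
      rw [← hc]
      refine (map_smul (slackFunctional (tightSum F r) P) (c : ℝ) P.toVec).trans ?_
      rw [slackFunctional_toVec, hF.slack_self hr hPr, Int.cast_zero, smul_zero]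
    rw [slackFunctional_toVec, Int.cast_eq_zero] at h0
    exact ((hF.slack_nonneg hr hq hPr hQq).2 h0).symm
  · rintro _ ⟨⟨ρ, hρ, rfl⟩, hface⟩
    have hmap : (symCone R).map ghzMap =
        PointedCone.hull ℝ (ghzMap '' (GHZSymbol.toVec '' E)) := by
      rw [hgen]
      exact Submodule.map_span _ _
    rw [hmap] at hface
    obtain ⟨_, ⟨_, ⟨P, hP, rfl⟩, rfl⟩, h⟩ := hface.exists_hull_singleton_eq hρ
    exact ⟨P, hP, h⟩

/-! ### The nine cones -/

/-- Inequalities exposing the extreme rays for `(α ∧ β) ∨ (α ∧ γ)`. -/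
def facetsJoinOfMeets : List Facet :=
  [(![0, 0, 0, 1], ![0, 0, 0, 1]), (![0, 0, 0, 1], ![1, 0, 0, 0]),
    (![0, 0, 1, 0], ![0, 0, 1, 0]), (![0, 0, 1, 0], ![0, 1, 0, 0]),
    (![0, 1, 0, 0], ![0, 0, 1, 0]), (![0, 1, 0, 0], ![0, 1, 0, 0]),
    (![0, 1, 1, 0], ![1, 0, 0, 1]), (![1, 0, 0, 0], ![0, 0, 0, 1]),
    (![1, 0, 0, 0], ![1, 0, 0, 0]), (![1, 0, 0, 1], ![0, 0, 1, 1]),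
    (![1, 0, 0, 1], ![0, 1, 0, 1])]

/-- Inequalities exposing the extreme rays for `α ∨ (β ∧ γ)`. -/
def facetsJoinMeet : List Facet :=
  [(![0, 0, 0, 1], ![0, 0, 0, 1]), (![0, 0, 1, 0], ![0, 0, 1, 0]),
    (![0, 0, 1, 1], ![0, 1, 0, 1]), (![0, 0, 1, 1], ![1, 0, 1, 0]),
    (![0, 1, 0, 0], ![0, 1, 0, 0]), (![0, 1, 0, 1], ![1, 0, 1, 0]),
    (![1, 0, 0, 0], ![1, 0, 0, 0]), (![1, 0, 1, 0], ![0, 1, 0, 1]),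
    (![1, 1, 0, 0], ![0, 0, 1, 1])]

/-- Inequalities exposing the extreme rays for `α ∨ β ∨ γ`. -/
def facetsABCJoin : List Facet :=
  [(![0, 0, 0, 1], ![0, 0, 0, 1]), (![0, 0, 1, 0], ![0, 0, 1, 0]),
    (![0, 1, 0, 0], ![0, 1, 0, 0]), (![1, 0, 0, 0], ![1, 0, 0, 0])]

theorem allExposed_repsABC : AllExposed repsABC (facetsA ++ facetsB ++ facetsC) := by
  decide +kernel

theorem mem_tableABCMeet (p : GHZSymbol) :
    p ∈ tableABCMeet ↔ ∃ r ∈ repsABC, p ∈ pmSymbols r.1 r.2 := by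
  simp only [tableABCMeet, tableDelta, repsABC, diagReps,
    Finset.mem_union, List.mem_append, List.mem_cons, List.not_mem_nil, or_false, or_and_right,
    exists_or, exists_eq_left, or_assoc]

theorem allExposed_repsAB : AllExposed repsAB (facetsA ++ facetsB) := by
  decide +kernel

theorem mem_tableABMeet (p : GHZSymbol) :
    p ∈ tableABMeet ↔ ∃ r ∈ repsAB, p ∈ pmSymbols r.1 r.2 := by
  simp only [tableABMeet, tableABCMeet, tableDelta, repsAB, repsABC, diagReps,
    Finset.mem_union, List.mem_append, List.mem_cons, List.not_mem_nil, or_false, or_and_right,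
    exists_or, exists_eq_left, or_assoc]

/-- For the exposing lists `facetsJoinOfMeets`, `facetsJoinMeet` and `facetsABCJoin`, completeness
is not needed: `AllExposed` checks directly that the tight sums are nonnegative on the generators.
-/
theorem allExposed_repsJoinOfMeets : AllExposed repsJoinOfMeets (facetsJoinOfMeets) := by
  decide +kernel

theorem mem_tableJoinOfMeets (p : GHZSymbol) :
    p ∈ tableJoinOfMeets ↔ ∃ r ∈ repsJoinOfMeets, p ∈ pmSymbols r.1 r.2 := by
  simp only [tableJoinOfMeets, tableABMeet, tableABCMeet, tableDelta, repsJoinOfMeets, repsAB,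
    repsABC, diagReps,
    Finset.mem_union, List.mem_append, List.mem_cons, List.not_mem_nil, or_false, or_and_right,
    exists_or, exists_eq_left, or_assoc]

theorem allExposed_repsMeetJoin : AllExposed repsMeetJoin (facetsA ++ facetsBCJoin) := by
  decide +kernel

theorem mem_tableMeetJoin (p : GHZSymbol) :
    p ∈ tableMeetJoin ↔ ∃ r ∈ repsMeetJoin, p ∈ pmSymbols r.1 r.2 := by
  simp only [tableMeetJoin, tableJoinOfMeets, tableABMeet, tableABCMeet, tableDelta,
    repsMeetJoin, repsJoinOfMeets, repsAB, repsABC, diagReps,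
    Finset.mem_union, List.mem_append, List.mem_cons, List.not_mem_nil, or_false, or_and_right,
    exists_or, exists_eq_left, or_assoc]

theorem allExposed_repsA : AllExposed repsA (facetsA) := by
  decide +kernel

theorem mem_tableA (p : GHZSymbol) : p ∈ tableA ↔ ∃ r ∈ repsA, p ∈ pmSymbols r.1 r.2 := by
  simp only [tableA, tableDelta, repsA, diagReps,
    Finset.mem_union, List.mem_append, List.mem_cons, List.not_mem_nil, or_false, or_and_right,
    exists_or, exists_eq_left, or_assoc]

theorem allExposed_repsJoinMeet : AllExposed repsJoinMeet (facetsJoinMeet) := by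
  decide +kernel

theorem mem_tableJoinMeet (p : GHZSymbol) :
    p ∈ tableJoinMeet ↔ ∃ r ∈ repsJoinMeet, p ∈ pmSymbols r.1 r.2 := by
  simp only [tableJoinMeet, tableA, tableDelta, repsJoinMeet, repsA, diagReps,
    Finset.mem_union, List.mem_append, List.mem_cons, List.not_mem_nil, or_false, or_and_right,
    exists_or, exists_eq_left, or_assoc]

theorem allExposed_repsMeetOfJoins : AllExposed repsMeetOfJoins (facetsABJoin ++ facetsACJoin) := by
  decide +kernel

theorem mem_tableMeetOfJoins (p : GHZSymbol) :
    p ∈ tableMeetOfJoins ↔ ∃ r ∈ repsMeetOfJoins, p ∈ pmSymbols r.1 r.2 := by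
  simp only [tableMeetOfJoins, tableJoinMeet, tableA, tableDelta, repsMeetOfJoins, repsJoinMeet,
    repsA, diagReps,
    Finset.mem_union, List.mem_append, List.mem_cons, List.not_mem_nil, or_false, or_and_right,
    exists_or, exists_eq_left, or_assoc]

theorem allExposed_repsABJoin : AllExposed repsABJoin (facetsABJoin) := by
  decide +kernel

theorem mem_tableABJoin (p : GHZSymbol) :
    p ∈ tableABJoin ↔ ∃ r ∈ repsABJoin, p ∈ pmSymbols r.1 r.2 := by
  simp only [tableABJoin, tableDelta, repsABJoin, repsA, diagReps,
    Finset.mem_union, List.mem_append, List.mem_cons, List.not_mem_nil, or_false, or_and_right,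
    exists_or, exists_eq_left, or_assoc]

theorem allExposed_repsABCJoin : AllExposed repsABCJoin (facetsABCJoin) := by
  decide +kernel

theorem mem_tableABCJoin (p : GHZSymbol) :
    p ∈ tableABCJoin ↔ ∃ r ∈ repsABCJoin, p ∈ pmSymbols r.1 r.2 := by
  simp only [tableABCJoin, tableABJoin, tableDelta, repsABCJoin, repsABJoin, repsA, diagReps,
    Finset.mem_union, List.mem_append, List.mem_cons, List.not_mem_nil, or_false, or_and_right,
    exists_or, exists_eq_left, or_assoc]

/-- In the lattice of convex cones `⊓` is the intersection and `⊔` is the convex hull of the union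
(the sum). -/
theorem mainTheorem8 :
    ListsGHZExtremeRays (alphaCone ⊓ betaCone ⊓ gammaCone) tableABCMeet 20 ∧
    ListsGHZExtremeRays (alphaCone ⊓ betaCone) tableABMeet 28 ∧
    ListsGHZExtremeRays ((alphaCone ⊓ betaCone) ⊔ (alphaCone ⊓ gammaCone)) tableJoinOfMeets 36 ∧
    ListsGHZExtremeRays (alphaCone ⊓ (betaCone ⊔ gammaCone)) tableMeetJoin 84 ∧
    ListsGHZExtremeRays alphaCone tableA 12 ∧
    ListsGHZExtremeRays (alphaCone ⊔ (betaCone ⊓ gammaCone)) tableJoinMeet 20 ∧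
    ListsGHZExtremeRays ((alphaCone ⊔ betaCone) ⊓ (alphaCone ⊔ gammaCone)) tableMeetOfJoins 52 ∧
    ListsGHZExtremeRays (alphaCone ⊔ betaCone) tableABJoin 20 ∧
    ListsGHZExtremeRays (alphaCone ⊔ betaCone ⊔ gammaCone) tableABCJoin 28 := by
  have hα := represents_alphaCone
  have hβ := represents_betaCone
  have hγ := represents_gammaCone
  refine ⟨?_, ?_, ?_, ?_, ?_, ?_, ?_, ?_, ?_⟩
  · have h := (hα.inf hβ).inf hγ
    rw [symCone_repsA_inf_repsB_inf_repsC] at h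
    exact h.listsGHZExtremeRays allExposed_repsABC mem_tableABCMeet (by decide +kernel)
  · have h := hα.inf hβ
    rw [symCone_repsA_inf_repsB] at h
    exact h.listsGHZExtremeRays allExposed_repsAB mem_tableABMeet (by decide +kernel)
  · have h := (hα.inf hβ).sup (hα.inf hγ)
    rw [symCone_repsJoinOfMeets] at h
    exact h.listsGHZExtremeRays allExposed_repsJoinOfMeets mem_tableJoinOfMeets (by decide +kernel)
  · have h := hα.inf (hβ.sup hγ)
    rw [symCone_repsA_inf_sup] at h
    exact h.listsGHZExtremeRays allExposed_repsMeetJoin mem_tableMeetJoin (by decide +kernel)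
  · exact hα.listsGHZExtremeRays allExposed_repsA mem_tableA (by decide +kernel)
  · have h := hα.sup (hβ.inf hγ)
    rw [symCone_repsJoinMeet] at h
    exact h.listsGHZExtremeRays allExposed_repsJoinMeet mem_tableJoinMeet (by decide +kernel)
  · have h := (hα.sup hβ).inf (hα.sup hγ)
    rw [symCone_repsA_sup_inf_sup] at h
    exact h.listsGHZExtremeRays allExposed_repsMeetOfJoins mem_tableMeetOfJoins (by decide +kernel)
  · have h := hα.sup hβ
    rw [symCone_repsABJoin] at h
    exact h.listsGHZExtremeRays allExposed_repsABJoin mem_tableABJoin (by decide +kernel)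
  · have h := (hα.sup hβ).sup hγ
    rw [symCone_repsABCJoin] at h
    exact h.listsGHZExtremeRays allExposed_repsABCJoin mem_tableABCJoin (by decide +kernel)
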